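/- Let $\mathbb K$ be an algebraically closed field of characteristic zero, $N$ a lattice of finite rank, $M=\mathrm{Hom}(N,\mathbb Z)$, and $\sigma\subset N_{\mathbb Q}=N\otimes_{\mathbb Z}\mathbb Q$ a strongly convex polyhedral cone. Put $S_\sigma=\sigma^\vee\cap M$, $\mathbb K[X_\sigma]=\bigoplus_{u\in S_\sigma}\mathbb K\chi^u$, and let $X_\sigma$ be the affine toric variety with this coordinate algebra. A *Demazure root* of $\sigma$ is an element $e\in M$ such that $\langle p,e\rangle=-1$ for the primitive vector $p$ on some ray of $\sigma$ and $\langle q,e\rangle\ge 0$ for the primitive vectors $q$ on all other rays of $\sigma$. Let $\tau$ be a $k$-dimensional face of $\sigma$ that is regular, i.e. the primitive vectors $p_1,\dots,p_k$ on its rays form part of a basis of $N$, and let $e_1^{(r)},e_2^{(r)}$, $r=1,\dots,k$, be Demazure roots of $\sigma$ that are compatible with $\tau$, i.e. $\langle p_s,e_1^{(r)}\rangle=\langle p_s,e_2^{(r)}\rangle=-\delta_{rs}$ for all $r,s=1,\dots,k$. Then the following hold. 1. For $u\in S_\sigma$ all exponents $\langle p_r,u\rangle$ are nonnegative, and the formula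 $$\chi^u\mapsto(\chi^u\otimes\chi^u)\prod_{r=1}^k\bigl(1\otimes\chi^{e_1^{(r)}}+\chi^{e_2^{(r)}}\otimes 1\bigr)^{\langle p_r,u\rangle},\qquad u\in S_\sigma,$$ where the right-hand side is computed in $\mathbb K[M]\otimes\mathbb K[M]$, has values in $\mathbb K[X_\sigma]\otimes\mathbb K[X_\sigma]$; the linear map $\Delta\colon\mathbb K[X_\sigma]\to\mathbb K[X_\sigma]\otimes\mathbb K[X_\sigma]$ that it defines is a homomorphism of algebras and a coassociative comultiplication, with counit the evaluation at the point $x_\tau\in X_\sigma$ given by $\chi^u(x_\tau)=1$ if $u\in\tau^\perp$ and $\chi^u(x_\tau)=0$ otherwise. 2. The morphism $X_\sigma\times X_\sigma\to X_\sigma$ with comorphism $\Delta$ makes $X_\sigma$ an affine algebraic monoid with neutral element $x_\tau$. 3. The group of invertible elements of this monoid coincides with $X_\tau$, the image of the morphism $X_\tau\to X_\sigma$ given by $\mathbb K[X_\sigma]\subseteq\mathbb K[X_\tau]$, which is the open embedding of a principal open subset. 4. Let $M(\tau)=\tau^\perp\cap M$ and $T=\mathrm{Hom}(M(\tau),\mathbb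 K^\times)$. Then $e_2^{(r)}-e_1^{(r)}\in M(\tau)$ for all $r$, and with the characters $\chi_r=\chi^{e_2^{(r)}-e_1^{(r)}}$ of $T$ the group of invertible elements $X_\tau$ is isomorphic, as an algebraic group, to the semidirect product $G_{\overline\chi}=\mathbb G_a^k\leftthreetimes T$ with multiplication $(\alpha\cdot t)(\alpha'\cdot t')=(\alpha_r+\chi_r(t)\alpha'_r)_{r}\cdot tt'$. -/

import Mathlib

open scoped TensorProduct

namespace RootMonoid

noncomputable section

/-! ### Cones, faces, rays -/

section Cones

variable {N : Type*} [AddCommGroup N]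

/-- The pairing `⟨·, u⟩ : N_ℚ → ℚ` with an element `u` of the dual lattice `M = Hom(N, ℤ)`,
where `N_ℚ = ℚ ⊗ N`. -/
def pairing (u : Module.Dual ℤ N) : (ℚ ⊗[ℤ] N) →ₗ[ℚ] ℚ :=
  ((Algebra.linearMap ℤ ℚ) ∘ₗ u).liftBaseChange ℚ

/-- Strongly convex polyhedral cones in `N_ℚ`: generated by finitely many vectors, and
containing no line. -/
structure IsStronglyConvexPolyhedral (σ : PointedCone ℚ (ℚ ⊗[ℤ] N)) : Prop where
  fg : Submodule.FG σ
  salient : (σ : ConvexCone ℚ (ℚ ⊗[ℤ] N)).Salient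

/-- The dimension of a cone is the dimension of its linear span. -/
def coneDim (σ : PointedCone ℚ (ℚ ⊗[ℤ] N)) : ℕ :=
  Module.finrank ℚ (Submodule.span ℚ (σ : Set (ℚ ⊗[ℤ] N)))

/-- A lattice vector is primitive if it is nonzero and not a proper integer multiple of a lattice
vector (`v = 0` is excluded because `0 = 0 • 0` and `0` is not a unit of `ℤ`). -/
def IsPrimitiveVector (v : N) : Prop :=
  ∀ (m : ℤ) (w : N), v = m • w → IsUnit m

/-- The set of primitive vectors on the one-dimensional faces of `σ`. -/
def rayVectors (σ : PointedCone ℚ (ℚ ⊗[ℤ] N)) : Set N :=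
  {v | IsPrimitiveVector v ∧ ∃ ρ : PointedCone ℚ (ℚ ⊗[ℤ] N),
    ρ.IsFaceOf σ ∧ coneDim ρ = 1 ∧ (1 : ℚ) ⊗ₜ[ℤ] v ∈ ρ}

/-- A cone is regular if the primitive vectors on its rays form part of a basis of `N`. -/
def IsRegularCone (σ : PointedCone ℚ (ℚ ⊗[ℤ] N)) : Prop :=
  ∃ b : Module.Basis (Fin (Module.finrank ℤ N)) ℤ N, rayVectors σ ⊆ Set.range b

/-- Demazure roots of `σ`: for some primitive ray vector `p`, the value on `p` is `-1` and the
values on all other primitive ray vectors are nonnegative. -/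
def IsDemazureRoot (σ : PointedCone ℚ (ℚ ⊗[ℤ] N)) (e : Module.Dual ℤ N) : Prop :=
  ∃ p ∈ rayVectors σ, e p = -1 ∧ ∀ q ∈ rayVectors σ, q ≠ p → 0 ≤ e q

/-- The semigroup `S_σ = σ^∨ ∩ M`. -/
def dualSemigroup (σ : PointedCone ℚ (ℚ ⊗[ℤ] N)) : AddSubmonoid (Module.Dual ℤ N) where
  carrier := {u | ∀ v ∈ σ, 0 ≤ pairing u v}
  zero_mem' := fun v _ => by simp [pairing]
  add_mem' := by
    intro a b ha hb v hv
    have h : pairing (a + b) v = pairing a v + pairing b v := by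
      simp [pairing, LinearMap.comp_add]
    rw [h]
    exact add_nonneg (ha v hv) (hb v hv)

/-- The sublattice `M(τ) = τ^⊥ ∩ M`. -/
def perpLattice (τ : PointedCone ℚ (ℚ ⊗[ℤ] N)) : AddSubgroup (Module.Dual ℤ N) where
  carrier := {u | ∀ v ∈ τ, pairing u v = 0}
  zero_mem' := fun v _ => by simp [pairing]
  add_mem' := by
    intro a b ha hb v hv
    have h : pairing (a + b) v = pairing a v + pairing b v := by
      simp [pairing, LinearMap.comp_add]
    rw [h, ha v hv, hb v hv, add_zero]
  neg_mem' := by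
    intro a ha v hv
    have h : pairing (-a) v = - pairing a v := by
      rw [eq_neg_iff_add_eq_zero]
      have h' : pairing (-a) v + pairing a v = pairing (-a + a) v := by
        simp [pairing]
      rw [h']
      simp [pairing]
    rw [h, ha v hv, neg_zero]

theorem dualSemigroup_anti {σ τ : PointedCone ℚ (ℚ ⊗[ℤ] N)} (h : τ ≤ σ) :
    dualSemigroup σ ≤ dualSemigroup τ :=
  fun _ hu v hv => hu v (h hv)

end Cones

/-! ### Affine varieties, given by their coordinate algebras -/

section Points

variable {K : Type*} [Field K] {A : Type*} [CommRing A] [Algebra K A]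

/-- The product of two `K`-points of the affine variety with coordinate algebra `A`, under the
morphism `X × X → X` whose comorphism is `Δ : A → A ⊗ A`. -/
def pointMul (Δ : A →ₐ[K] A ⊗[K] A) (x y : A →ₐ[K] K) : A →ₐ[K] K :=
  (Algebra.TensorProduct.lift x y (fun _ _ => Commute.all _ _)).comp Δ

/-- `Δ` is a comultiplication on the coordinate algebra with counit `ε`: it is coassociative and
`ε` (a point of the variety) is a two-sided counit. -/
structure IsComultiplication (Δ : A →ₐ[K] A ⊗[K] A) (ε : A →ₐ[K] K) : Prop where
  coassoc : (Algebra.TensorProduct.assoc K K K A A A).toAlgHom.comp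
      ((Algebra.TensorProduct.map Δ (AlgHom.id K A)).comp Δ) =
    (Algebra.TensorProduct.map (AlgHom.id K A) Δ).comp Δ
  counit_left : (Algebra.TensorProduct.lid K A).toAlgHom.comp
      ((Algebra.TensorProduct.map ε (AlgHom.id K A)).comp Δ) = AlgHom.id K A
  counit_right : (Algebra.TensorProduct.rid K K A).toAlgHom.comp
      ((Algebra.TensorProduct.map (AlgHom.id K A) ε).comp Δ) = AlgHom.id K A

/-- The homomorphism of coordinate algebras `φ : A → B` is the localization of `A` at `f`, i.e.
the corresponding morphism of affine varieties is the open embedding of the principal open subset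
`f ≠ 0`. -/
def IsPrincipalOpenEmbedding {B : Type*} [CommRing B] [Algebra K B] (φ : A →ₐ[K] B) (f : A) :
    Prop :=
  @IsLocalization.Away A _ f B _ φ.toRingHom.toAlgebra

end Points

/-! ### Affine toric varieties -/

section Toric

variable (K : Type*) [Field K] {N : Type*} [AddCommGroup N]

/-- The coordinate algebra `K[X_σ] = ⨁_{u ∈ S_σ} K χ^u`. -/
abbrev CoordRing (σ : PointedCone ℚ (ℚ ⊗[ℤ] N)) : Type _ :=
  AddMonoidAlgebra K (dualSemigroup σ)

/-- The points of the affine toric variety `X_σ`. -/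
abbrev ToricVariety (σ : PointedCone ℚ (ℚ ⊗[ℤ] N)) : Type _ :=
  CoordRing K σ →ₐ[K] K

/-- The character `χ^u`, as an element of the Laurent polynomial algebra `K[M]`. -/
def chi (u : Module.Dual ℤ N) : AddMonoidAlgebra K (Module.Dual ℤ N) :=
  AddMonoidAlgebra.single u 1

/-- The character `χ^u`, `u ∈ S_σ`, as an element of `K[X_σ]`. -/
def chiS {σ : PointedCone ℚ (ℚ ⊗[ℤ] N)} (u : dualSemigroup σ) : CoordRing K σ :=
  AddMonoidAlgebra.single u 1

/-- The inclusion `K[X_σ] ⊆ K[M]`. -/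
def inclM (σ : PointedCone ℚ (ℚ ⊗[ℤ] N)) :
    CoordRing K σ →ₐ[K] AddMonoidAlgebra K (Module.Dual ℤ N) :=
  AddMonoidAlgebra.mapDomainAlgHom K K (dualSemigroup σ).subtype

/-- The inclusion `K[X_σ] ⊆ K[X_τ]` for `τ ⊆ σ`. -/
def restrictHom {σ τ : PointedCone ℚ (ℚ ⊗[ℤ] N)} (h : τ ≤ σ) :
    CoordRing K σ →ₐ[K] CoordRing K τ :=
  AddMonoidAlgebra.mapDomainAlgHom K K (AddSubmonoid.inclusion (dualSemigroup_anti h))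

/-- The subset `X_τ ⊆ X_σ`: the image of the morphism `X_τ → X_σ`. -/
def toricSubset {σ τ : PointedCone ℚ (ℚ ⊗[ℤ] N)} (h : τ ≤ σ) : Set (ToricVariety K σ) :=
  Set.range fun y : ToricVariety K τ => y.comp (restrictHom K h)

open scoped Classical in
/-- The distinguished point `x_τ ∈ X_σ`: `χ^u ↦ 1` if `u ∈ τ^⊥` and `χ^u ↦ 0` otherwise. -/
def distinguishedPoint {σ τ : PointedCone ℚ (ℚ ⊗[ℤ] N)} (h : τ ≤ σ) : ToricVariety K σ :=
  AddMonoidAlgebra.lift K K (dualSemigroup σ)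
    { toFun := fun u => if (u.toAdd : Module.Dual ℤ N) ∈ perpLattice τ then 1 else 0
      map_one' := if_pos (perpLattice τ).zero_mem
      map_mul' := by
        intro a b
        have key : ((a * b).toAdd : Module.Dual ℤ N) ∈ perpLattice τ ↔
            (a.toAdd : Module.Dual ℤ N) ∈ perpLattice τ ∧
            (b.toAdd : Module.Dual ℤ N) ∈ perpLattice τ := by
          constructor
          · intro hab
            have hv : ∀ v ∈ τ, pairing (a.toAdd : Module.Dual ℤ N) v = 0 ∧
                pairing (b.toAdd : Module.Dual ℤ N) v = 0 := by
              intro v hv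
              have h0 : pairing (a.toAdd : Module.Dual ℤ N) v +
                  pairing (b.toAdd : Module.Dual ℤ N) v = 0 := by
                have := hab v hv
                simpa [pairing, LinearMap.comp_add] using this
              have ha := a.toAdd.2 v (h hv)
              have hb := b.toAdd.2 v (h hv)
              constructor <;> linarith
            exact ⟨fun v hv' => (hv v hv').1, fun v hv' => (hv v hv').2⟩
          · rintro ⟨ha, hb⟩
            exact (perpLattice τ).add_mem ha hb
        by_cases ha : (a.toAdd : Module.Dual ℤ N) ∈ perpLattice τ <;>
          by_cases hb : (b.toAdd : Module.Dual ℤ N) ∈ perpLattice τ <;>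
          simp only [key, ha, hb, and_self, and_true, and_false, if_true, if_false, mul_one,
            mul_zero] }

end Toric

/-! ### The semidirect product of a vector group and a torus -/

section SemidirectProduct

variable (K : Type*) [Field K] {L : Type*} [AddCommGroup L] {k : ℕ}

/-- The torus `Hom(L, Kˣ)` with character lattice `L`. -/
abbrev Torus (L : Type*) [AddCommGroup L] : Type _ := Multiplicative L →* Kˣ

/-- The homomorphism `t ↦ (χ_1(t), …, χ_k(t))`, where `χ_r(t) = t(c_r)` is the character given by
`c_r ∈ L`. -/
def charValues (c : Fin k → L) : Torus K L →* (Fin k → Kˣ) where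
  toFun t r := t (Multiplicative.ofAdd (c r))
  map_one' := rfl
  map_mul' _ _ := rfl

/-- The action of the torus on `𝔾_a^k` (written multiplicatively) by `diag(χ_1(t), …, χ_k(t))`. -/
def diagAction (c : Fin k → L) : Torus K L →* MulAut (Multiplicative (Fin k → K)) :=
  (MulAutMultiplicative (Fin k → K)).symm.toMonoidHom.comp
    ((DistribMulAction.toAddAut (Fin k → Kˣ) (Fin k → K)).comp (charValues K c))

/-- The group `G_χ̄ = 𝔾_a^k ⋋ T`. -/
abbrev SemidirectGroup (c : Fin k → L) : Type _ :=
  Multiplicative (Fin k → K) ⋊[diagAction K c] Torus K L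

/-- The coordinate algebra `K[T][α_1, …, α_k]` of the variety `𝔸^k × T` underlying `G_χ̄`. -/
abbrev SemidirectCoordRing (L : Type*) [AddCommGroup L] (k : ℕ) : Type _ :=
  MvPolynomial (Fin k) (AddMonoidAlgebra K L)

/-- Evaluation of regular functions on `G_χ̄` at the element `g = α · t`. -/
def evalAt {c : Fin k → L} (g : SemidirectGroup K c) : SemidirectCoordRing K L k →ₐ[K] K :=
  MvPolynomial.aevalTower
    (AddMonoidAlgebra.lift K K L ((Units.coeHom K).comp g.right)) (Multiplicative.toAdd g.left)

/-- Multiplication in `G_χ̄`: the torus components are multiplied, and the `r`-th additive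
coordinate of `(α · t)(α' · t')` is `α_r + χ_r(t) α'_r`. -/
theorem semidirectGroup_mul {c : Fin k → L} (g h : SemidirectGroup K c) :
    (g * h).right = g.right * h.right ∧
    ∀ r, Multiplicative.toAdd (g * h).left r = Multiplicative.toAdd g.left r +
      (g.right (Multiplicative.ofAdd (c r)) : K) * Multiplicative.toAdd h.left r :=
  ⟨rfl, fun _ => rfl⟩

end SemidirectProduct

end

end RootMonoid

/-! Everything is read off from the open subset `X_τ`. The functionals `-e₁ r` are dual to the ray
vectors `p r` of `τ`, so each `u ∈ S_τ` is uniquely an element of `M(τ)` plus the combination of the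
`-e₁ r` with coefficients `u (p r) ≥ 0`. Hence `K[X_τ] = K[M(τ)][α_1, …, α_k]` with `α_r = χ^{-e₁
r}`, that is, `X_τ ≅ 𝔸^k × T` (`semidirectEquiv`).

The group law of `G_χ̄` has comorphism `α_r ↦ α_r ⊗ 1 + χ_r ⊗ α_r`. With `χ_r = χ^{e₂ r - e₁ r}` the
right side equals `(χ^{-e₁ r} ⊗ χ^{-e₁ r}) (1 ⊗ χ^{e₁ r} + χ^{e₂ r} ⊗ 1)`, so on `χ^u` the
comorphism is the formula of the theorem (`comul_restrictToSemidirect_single`). The comultiplication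
axioms therefore pass from the group to `K[X_σ]`, a subalgebra of `K[X_τ]`, once the formula is
known to preserve `K[X_σ]`. This is where Demazure roots enter: if `u ∈ S_σ` is positive on `p r`,
then `u + e₁ r` and `u + e₂ r` stay in `S_σ`, so every term of the expanded product has both
exponents in `S_σ` (`mul_prod_mem_range`).

For the invertible elements, a functional exposing the face `τ` yields `w ∈ S_σ ∩ τ^⊥` such that
`X_τ` is the locus `χ^w ≠ 0` (`exists_dualSemigroup_face_eq`). As `χ^w` is group-like, it does not
vanish at an invertible point; conversely `X_τ` is the image of the group `G_χ̄`. -/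

namespace RootMonoid

noncomputable section

/-! ### Convex geometry: Gordan's theorem, exposed faces, extremal rays. -/

section Convexity

variable {𝕜 : Type*} [Field 𝕜] [LinearOrder 𝕜] [IsStrictOrderedRing 𝕜]

/-- Gordan's theorem: finitely many vectors without a nontrivial nonnegative relation lie in an
open half-space. -/
theorem exists_dual_forall_pos {ι : Type*} (s : Finset ι) {V : Type*} [AddCommGroup V]
    [Module 𝕜 V] (g : ι → V)
    (h : ∀ c : ι → 𝕜, (∀ i ∈ s, 0 ≤ c i) → ∑ i ∈ s, c i • g i = 0 → ∀ i ∈ s, c i = 0) :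
    ∃ φ : V →ₗ[𝕜] 𝕜, ∀ i ∈ s, 0 < φ (g i) := by
  classical
  induction s using Finset.induction_on generalizing V with
  | empty => exact ⟨0, by simp⟩
  | insert a s ha ih =>
    have upd : ∀ (c : ι → 𝕜) (t : 𝕜), ∑ i ∈ insert a s, Function.update c a t i • g i =
        t • g a + ∑ i ∈ s, c i • g i := by
      intro c t
      rw [Finset.sum_insert ha, Function.update_self]
      congr 1
      refine Finset.sum_congr rfl fun i hi => ?_
      rw [Function.update_of_ne (ne_of_mem_of_not_mem hi ha)]
    have rel : ∀ (c : ι → 𝕜) (t : 𝕜), (∀ i ∈ s, 0 ≤ c i) → 0 ≤ t →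
        t • g a + ∑ i ∈ s, c i • g i = 0 → t = 0 ∧ ∀ i ∈ s, c i = 0 := by
      intro c t hc ht hsum
      have key := h (Function.update c a t) (by
        intro i hi
        rcases Finset.mem_insert.1 hi with rfl | hi
        · simpa using ht
        · rw [Function.update_of_ne (ne_of_mem_of_not_mem hi ha)]
          exact hc i hi) ((upd c t).trans hsum)
      refine ⟨by simpa using key a (Finset.mem_insert_self _ _), fun i hi => ?_⟩
      have := key i (Finset.mem_insert_of_mem hi)
      rwa [Function.update_of_ne (ne_of_mem_of_not_mem hi ha)] at this
    have hga : g a ≠ 0 := fun h0 => one_ne_zero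
      (rel 0 1 (by simp) zero_le_one (by simp [h0])).1
    -- If `g a` is a nonnegative combination of the others, a functional for `s` is already positive
    -- on it. Otherwise the induction hypothesis applies modulo `g a`, and a large multiple of the
    -- lifted functional is added to one with value `1` at `g a`.
    by_cases hc : ∃ c : ι → 𝕜, (∀ i ∈ s, 0 ≤ c i) ∧ g a = ∑ i ∈ s, c i • g i
    · obtain ⟨c, hc, hgc⟩ := hc
      obtain ⟨φ, hφ⟩ := ih g fun d hd hsum => (rel d 0 hd le_rfl (by simpa using hsum)).2
      refine ⟨φ, fun i hi => ?_⟩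
      rcases Finset.mem_insert.1 hi with rfl | hi
      · have hval : φ (g i) = ∑ j ∈ s, c j * φ (g j) := by
          rw [hgc]
          simp
        have hnn : ∀ j ∈ s, 0 ≤ c j * φ (g j) := fun j hj => mul_nonneg (hc j hj) (hφ j hj).le
        rw [hval]
        refine lt_of_le_of_ne (Finset.sum_nonneg hnn) fun h0 => hga ?_
        rw [hgc]
        refine Finset.sum_eq_zero fun j hj => ?_
        have := (Finset.sum_eq_zero_iff_of_nonneg hnn).1 h0.symm j hj
        rw [(mul_eq_zero.1 this).resolve_right (hφ j hj).ne', zero_smul]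
      · exact hφ i hi
    · obtain ⟨φ₀, hφ₀⟩ := ih (V := V ⧸ Submodule.span 𝕜 {g a})
        (fun i => (Submodule.span 𝕜 {g a}).mkQ (g i)) (by
          intro c hcn hsum
          have hmem : ∑ i ∈ s, c i • g i ∈ Submodule.span 𝕜 {g a} := by
            rw [← Submodule.ker_mkQ (Submodule.span 𝕜 {g a}), LinearMap.mem_ker]
            simpa using hsum
          obtain ⟨t, ht⟩ := Submodule.mem_span_singleton.1 hmem
          -- For `t ≤ 0` this is a nonnegative relation among all the vectors; for `t > 0` it would
          -- exhibit `g a` as a nonnegative combination of the others.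
          rcases le_or_gt t 0 with htn | htp
          · exact (rel c (-t) hcn (neg_nonneg.2 htn) (by rw [← ht]; simp)).2
          · refine absurd ⟨fun i => t⁻¹ * c i,
              fun i hi => mul_nonneg (inv_nonneg.2 htp.le) (hcn i hi), ?_⟩ hc
            simp_rw [mul_smul]
            rw [← Finset.smul_sum, ← ht, smul_smul, inv_mul_cancel₀ htp.ne', one_smul])
      obtain ⟨φ₁, hφ₁⟩ : ∃ φ₁ : V →ₗ[𝕜] 𝕜, φ₁ (g a) ≠ 0 := by
        by_contra! hcon
        exact hga ((Module.forall_dual_apply_eq_zero_iff 𝕜 (g a)).1 hcon)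
      have hev : ∀ᶠ n : 𝕜 in Filter.atTop, ∀ i ∈ s, 0 < (φ₁ (g a))⁻¹ * φ₁ (g i) +
          n * φ₀ ((Submodule.span 𝕜 {g a}).mkQ (g i)) := by
        refine (Filter.eventually_all_finset s).2 fun i hi => ?_
        exact (Filter.tendsto_atTop_add_const_left _ _
          (Filter.tendsto_id.atTop_mul_const (hφ₀ i hi))).eventually_gt_atTop 0
      obtain ⟨n, hn⟩ := hev.exists
      refine ⟨(φ₁ (g a))⁻¹ • φ₁ + n • (φ₀ ∘ₗ (Submodule.span 𝕜 {g a}).mkQ), fun i hi => ?_⟩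
      rcases Finset.mem_insert.1 hi with rfl | hi
      · have h0 : (Submodule.span 𝕜 {g i}).mkQ (g i) = 0 := by
          simp [Submodule.mem_span_singleton_self]
        simp [h0, hφ₁, -Submodule.mkQ_apply]
      · simpa using hn i hi

variable {V : Type*} [AddCommGroup V] [Module 𝕜 V]

theorem exists_sub_of_mem_span_cone {C : PointedCone 𝕜 V} {x : V}
    (hx : x ∈ Submodule.span 𝕜 (C : Set V)) : ∃ y ∈ C, ∃ z ∈ C, x = y - z := by
  induction hx using Submodule.span_induction with
  | mem x hx => exact ⟨x, hx, 0, zero_mem _, by simp⟩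
  | zero => exact ⟨0, zero_mem _, 0, zero_mem _, by simp⟩
  | add x y _ _ hx hy =>
    obtain ⟨a, ha, b, hb, rfl⟩ := hx
    obtain ⟨c, hc, d, hd, rfl⟩ := hy
    exact ⟨a + c, add_mem ha hc, b + d, add_mem hb hd, by abel⟩
  | smul t x _ hx =>
    obtain ⟨a, ha, b, hb, rfl⟩ := hx
    rcases le_total 0 t with ht | ht
    · exact ⟨t • a, C.smul_mem ht ha, t • b, C.smul_mem ht hb, smul_sub _ _ _⟩
    · refine ⟨(-t) • b, C.smul_mem (neg_nonneg.2 ht) hb, (-t) • a,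
        C.smul_mem (neg_nonneg.2 ht) ha, ?_⟩
      rw [smul_sub, neg_smul, neg_smul]
      abel

/-- The faces of a finitely generated cone are exposed. -/
theorem exists_dual_eq_zero_on_face {C F : PointedCone 𝕜 V} (hC : Submodule.FG C)
    (hF : F.IsFaceOf C) :
    ∃ φ : V →ₗ[𝕜] 𝕜, (∀ x ∈ F, φ x = 0) ∧ (∀ x ∈ C, 0 ≤ φ x) ∧ ∀ x ∈ C, φ x = 0 → x ∈ F := by
  classical
  obtain ⟨G, rfl⟩ := hC
  -- Gordan's theorem is applied modulo the span of `F` to the generators outside `F`. A relation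
  -- there becomes, after adding a vector of `F`, a sum of elements of `C` lying in `F`; the face
  -- property then puts every generator with positive coefficient in `F`.
  obtain ⟨φ, hφ⟩ := exists_dual_forall_pos (𝕜 := 𝕜) (G.filter (· ∉ F))
    (fun x => (Submodule.span 𝕜 (F : Set V)).mkQ x) (by
      intro c hc hsum i hi
      have hmem : ∑ i ∈ G.filter (· ∉ F), c i • i ∈ Submodule.span 𝕜 (F : Set V) := by
        rw [← Submodule.ker_mkQ (Submodule.span 𝕜 (F : Set V)), LinearMap.mem_ker]
        simpa using hsum
      obtain ⟨y, hy, z, hz, hyz⟩ := exists_sub_of_mem_span_cone hmem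
      have hterm : ∀ j ∈ G.filter (· ∉ F), c j • j ∈ Submodule.span {c : 𝕜 // 0 ≤ c} (G : Set V) :=
        fun j hj => Submodule.smul_mem _ (⟨c j, hc j hj⟩ : {c : 𝕜 // 0 ≤ c})
          (Submodule.subset_span (Finset.mem_filter.1 hj).1)
      have htot : c i • i + (∑ j ∈ (G.filter (· ∉ F)).erase i, c j • j + z) ∈ F := by
        rw [← add_assoc, Finset.add_sum_erase _ (fun j => c j • j) hi, hyz]
        simpa using hy
      by_contra hne
      refine (Finset.mem_filter.1 hi).2 (hF.mem_of_smul_add_mem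
        (Submodule.subset_span (Finset.mem_filter.1 hi).1) ?_
        (lt_of_le_of_ne (hc i hi) (Ne.symm hne)) htot)
      exact add_mem (sum_mem fun j hj => hterm j (Finset.mem_of_mem_erase hj)) (hF.le hz))
  have hF0 : ∀ x ∈ F, φ ((Submodule.span 𝕜 (F : Set V)).mkQ x) = 0 := by
    intro x hx
    have : (Submodule.span 𝕜 (F : Set V)).mkQ x = 0 := by
      simpa using Submodule.subset_span hx
    rw [this, map_zero]
  have hC0 : ∀ x ∈ Submodule.span {c : 𝕜 // 0 ≤ c} (G : Set V),
      0 ≤ φ ((Submodule.span 𝕜 (F : Set V)).mkQ x) ∧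
      (φ ((Submodule.span 𝕜 (F : Set V)).mkQ x) = 0 → x ∈ F) := by
    intro x hx
    induction hx using Submodule.span_induction with
    | mem x hx =>
      by_cases hxF : x ∈ F
      · exact ⟨(hF0 x hxF).ge, fun _ => hxF⟩
      · have := hφ x (Finset.mem_filter.2 ⟨hx, hxF⟩)
        exact ⟨this.le, fun h => absurd h this.ne'⟩
    | zero => exact ⟨by simp, fun _ => zero_mem _⟩
    | add x y _ _ hx hy =>
      rw [map_add, map_add]
      exact ⟨add_nonneg hx.1 hy.1, fun h => add_mem (hx.2 (by linarith [hx.1, hy.1]))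
        (hy.2 (by linarith [hx.1, hy.1]))⟩
    | smul t x _ hx =>
      have e : φ ((Submodule.span 𝕜 (F : Set V)).mkQ (t • x)) =
          (t : 𝕜) * φ ((Submodule.span 𝕜 (F : Set V)).mkQ x) := by
        change φ ((Submodule.span 𝕜 (F : Set V)).mkQ ((t : 𝕜) • x)) = _
        rw [map_smul, map_smul, smul_eq_mul]
      rw [e]
      refine ⟨mul_nonneg t.2 hx.1, fun h => ?_⟩
      rcases mul_eq_zero.1 h with h | h
      · have : t = 0 := Subtype.ext h
        rw [this, zero_smul]
        exact zero_mem _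
      · exact F.smul_mem t.2 (hx.2 h)
  exact ⟨φ ∘ₗ (Submodule.span 𝕜 (F : Set V)).mkQ, hF0, fun x hx => (hC0 x hx).1,
    fun x hx => (hC0 x hx).2⟩

/-- The generators of `C` that lie in `F` suffice, because a sum of elements of `C` lies in a face
only if each summand does. -/
theorem fg_of_isFaceOf {C F : PointedCone 𝕜 V} (hC : Submodule.FG C) (hF : F.IsFaceOf C) :
    Submodule.FG F := by
  classical
  obtain ⟨G, rfl⟩ := hC
  refine ⟨G.filter (· ∈ F), le_antisymm (Submodule.span_le.2 fun x hx =>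
    (Finset.mem_filter.1 hx).2) fun x hx => ?_⟩
  have key : ∀ x ∈ Submodule.span {c : 𝕜 // 0 ≤ c} (G : Set V), x ∈ F →
      x ∈ Submodule.span {c : 𝕜 // 0 ≤ c} (G.filter (· ∈ F) : Set V) := by
    intro x hx
    induction hx using Submodule.span_induction with
    | mem x hx => exact fun h => Submodule.subset_span (Finset.mem_filter.2 ⟨hx, h⟩)
    | zero => exact fun _ => zero_mem _
    | add x y hxC hyC hx hy =>
      exact fun h => add_mem (hx (hF.mem_of_add_mem_left hxC hyC h))
        (hy (hF.mem_of_add_mem_right hxC hyC h))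
    | smul t x hxC hx =>
      intro h
      rcases eq_or_lt_of_le t.2 with ht | ht
      · have : t = 0 := Subtype.ext ht.symm
        rw [this, zero_smul]
        exact zero_mem _
      · refine Submodule.smul_mem _ t (hx (hF.mem_of_smul_add_mem hxC (zero_mem _) ht ?_))
        rw [add_zero]
        exact h
  exact key x (hF.le hx) hx

/-- A finitely generated salient cone is generated by vectors spanning faces. -/
theorem exists_finset_span_eq_of_salient {C : PointedCone 𝕜 V} (hC : Submodule.FG C)
    (hs : (C : ConvexCone 𝕜 V).Salient) :
    ∃ G : Finset V, Submodule.span {c : 𝕜 // 0 ≤ c} (G : Set V) = C ∧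
      ∀ g ∈ G, g ≠ 0 ∧ PointedCone.IsFaceOf (Submodule.span {c : 𝕜 // 0 ≤ c} {g}) C := by
  classical
  -- A generating set of least cardinality is chosen; none of its elements is then in the cone of
  -- the others.
  have hex : ∃ n, ∃ G : Finset V, Submodule.span {c : 𝕜 // 0 ≤ c} (G : Set V) = C ∧ G.card = n := by
    obtain ⟨G, hG⟩ := hC
    exact ⟨_, G, hG, rfl⟩
  obtain ⟨G, hG, hcard⟩ := Nat.find_spec hex
  have hmin : ∀ g ∈ G, g ∉ Submodule.span {c : 𝕜 // 0 ≤ c} ((G.erase g : Finset V) : Set V) := by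
    intro g hg hmem
    refine Nat.find_min hex (m := (G.erase g).card)
      (by rw [← hcard]; exact Finset.card_erase_lt_of_mem hg) ⟨G.erase g, ?_, rfl⟩
    rw [← hG]
    refine le_antisymm (Submodule.span_mono (Finset.erase_subset _ _)) (Submodule.span_le.2 ?_)
    intro x hx
    by_cases hxg : x = g
    · exact hxg ▸ hmem
    · exact Submodule.subset_span (Finset.mem_erase.2 ⟨hxg, hx⟩)
  refine ⟨G, hG, fun g hg => ⟨fun h0 => hmin g hg (h0 ▸ zero_mem _), ?_⟩⟩
  have hgC : g ∈ C := hG ▸ Submodule.subset_span hg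
  have hle : Submodule.span {c : 𝕜 // 0 ≤ c} ((G.erase g : Finset V) : Set V) ≤ C :=
    hG ▸ Submodule.span_mono (Finset.erase_subset _ _)
  have hdec : ∀ x ∈ C, ∃ a : {c : 𝕜 // 0 ≤ c}, ∃ x' ∈ Submodule.span {c : 𝕜 // 0 ≤ c}
      ((G.erase g : Finset V) : Set V), x = a • g + x' := by
    intro x hx
    rw [← hG, ← Finset.insert_erase hg, Finset.coe_insert] at hx
    exact Submodule.mem_span_insert.1 hx
  refine PointedCone.IsFaceOf.of_mem_of_add_mem_left
    ((Submodule.span_singleton_le_iff_mem _ _).2 hgC) fun {x y} hx hy hxy => ?_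
  obtain ⟨a, x', hx', rfl⟩ := hdec x hx
  obtain ⟨b, y', hy', rfl⟩ := hdec y hy
  obtain ⟨c, hc⟩ := Submodule.mem_span_singleton.1 hxy
  have hc' : (c : 𝕜) • g = ((a : 𝕜) • g + x') + ((b : 𝕜) • g + y') := hc
  have hrel : ((c : 𝕜) - a - b) • g = x' + y' := by
    rw [sub_smul, sub_smul, hc']
    abel
  -- In `hrel`, a positive coefficient would put `g` in the cone of the other generators, against
  -- minimality; a nonpositive one would put `-x'` in `C`, against salience.
  have hx0 : x' = 0 := by
    by_contra hne
    rcases lt_or_ge 0 ((c : 𝕜) - a - b) with hpos | hneg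
    · apply hmin g hg
      have hm : ((c : 𝕜) - a - b)⁻¹ • (x' + y') ∈ Submodule.span {c : 𝕜 // 0 ≤ c}
          ((G.erase g : Finset V) : Set V) :=
        Submodule.smul_mem _ (⟨_, inv_nonneg.2 hpos.le⟩ : {c : 𝕜 // 0 ≤ c}) (add_mem hx' hy')
      rwa [← hrel, smul_smul, inv_mul_cancel₀ hpos.ne', one_smul] at hm
    · refine hs x' (hle hx') hne ?_
      have : -x' = y' + (-((c : 𝕜) - a - b)) • g := by
        rw [neg_smul, hrel]
        abel
      rw [this]
      exact add_mem (hle hy')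
        (C.smul_mem (neg_nonneg.2 hneg) hgC)
  rw [hx0, add_zero]
  exact Submodule.smul_mem _ a (Submodule.mem_span_singleton_self g)

end Convexity

/-! ### Primitive vectors, and dual semigroups described by rays. -/

section Lattice

variable {N : Type*} [AddCommGroup N]

theorem pairing_tmul (u : Module.Dual ℤ N) (q : ℚ) (v : N) :
    pairing u (q ⊗ₜ[ℤ] v) = q * (u v : ℚ) := by
  simp [pairing]

theorem pairing_add (u w : Module.Dual ℤ N) (v : ℚ ⊗[ℤ] N) :
    pairing (u + w) v = pairing u v + pairing w v := by
  simp [pairing, LinearMap.comp_add]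

theorem pairing_nsmul (n : ℕ) (u : Module.Dual ℤ N) (v : ℚ ⊗[ℤ] N) :
    pairing (n • u) v = n * pairing u v := by
  induction n with
  | zero => simp [pairing]
  | succ n ih => rw [succ_nsmul, pairing_add, ih]; push_cast; ring

theorem IsPrimitiveVector.neg {v : N} (hv : IsPrimitiveVector v) : IsPrimitiveVector (-v) :=
  fun m w h => hv m (-w) (by rw [smul_neg, ← h, neg_neg])

theorem IsStronglyConvexPolyhedral.face {σ τ : PointedCone ℚ (ℚ ⊗[ℤ] N)}
    (hσ : IsStronglyConvexPolyhedral σ) (hτ : τ.IsFaceOf σ) : IsStronglyConvexPolyhedral τ :=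
  ⟨fg_of_isFaceOf hσ.fg hτ, hσ.salient.anti hτ.le⟩

theorem mem_dualSemigroup_span {G : Set (ℚ ⊗[ℤ] N)} {u : Module.Dual ℤ N} :
    u ∈ dualSemigroup (Submodule.span {c : ℚ // 0 ≤ c} G : PointedCone ℚ (ℚ ⊗[ℤ] N)) ↔
      ∀ v ∈ G, 0 ≤ pairing u v := by
  refine ⟨fun h v hv => h v (Submodule.subset_span hv), fun h v hv => ?_⟩
  induction hv using Submodule.span_induction with
  | mem x hx => exact h x hx
  | zero => simp
  | add x y _ _ hx hy => rw [map_add]; exact add_nonneg hx hy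
  | smul t x _ hx =>
    change 0 ≤ pairing u ((t : ℚ) • x)
    rw [map_smul, smul_eq_mul]
    exact mul_nonneg t.2 hx

theorem mem_perpLattice_iff {σ : PointedCone ℚ (ℚ ⊗[ℤ] N)} {u : Module.Dual ℤ N} :
    u ∈ perpLattice σ ↔ u ∈ dualSemigroup σ ∧ -u ∈ dualSemigroup σ := by
  have hneg : ∀ v, pairing (-u) v = -pairing u v := fun v => by
    rw [eq_neg_iff_add_eq_zero, ← pairing_add]
    simp [pairing]
  constructor
  · exact fun h => ⟨fun v hv => (h v hv).ge, fun v hv => by rw [hneg, h v hv, neg_zero]⟩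
  · rintro ⟨h1, h2⟩ v hv
    have := h2 v hv
    rw [hneg] at this
    exact le_antisymm (neg_nonneg.1 this) (h1 v hv)

theorem rayVectors_face {σ τ : PointedCone ℚ (ℚ ⊗[ℤ] N)} (hτ : τ.IsFaceOf σ) :
    rayVectors τ ⊆ rayVectors σ :=
  fun _ ⟨hv, ρ, hρ, hd, hm⟩ => ⟨hv, ρ, hρ.trans hτ, hd, hm⟩

variable [Module.Free ℤ N] [Module.Finite ℤ N]

/-- Dividing by a non-unit factor strictly decreases the absolute value of a fixed nonzero
coordinate, so repeated division stops at a primitive vector. -/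
theorem exists_primitive_of_ne_zero {v : N} (hv : v ≠ 0) :
    ∃ (m : ℤ) (p : N), IsPrimitiveVector p ∧ v = m • p := by
  obtain ⟨j, hj⟩ : ∃ j, (Module.Free.chooseBasis ℤ N).repr v j ≠ 0 := by
    by_contra! h
    exact hv ((Module.Free.chooseBasis ℤ N).repr.map_eq_zero_iff.1 (Finsupp.ext h))
  induction hn : ((Module.Free.chooseBasis ℤ N).repr v j).natAbs using Nat.strong_induction_on
    generalizing v with
  | _ n ih =>
    by_cases hp : IsPrimitiveVector v
    · exact ⟨1, v, hp, (one_smul _ _).symm⟩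
    · simp only [IsPrimitiveVector, not_forall] at hp
      obtain ⟨m, w, rfl, hm⟩ := hp
      have hw : (Module.Free.chooseBasis ℤ N).repr w j ≠ 0 := fun h => hj (by simp [h])
      have hm0 : m ≠ 0 := fun h => hj (by simp [h])
      have hlt : ((Module.Free.chooseBasis ℤ N).repr w j).natAbs < n := by
        rw [← hn, map_smul, Finsupp.smul_apply, smul_eq_mul, Int.natAbs_mul]
        have h1 : 0 < ((Module.Free.chooseBasis ℤ N).repr w j).natAbs := Int.natAbs_pos.2 hw
        have h2 : m.natAbs ≠ 1 := fun h => hm (Int.isUnit_iff_natAbs_eq.2 h)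
        have h3 : 0 < m.natAbs := Int.natAbs_pos.2 hm0
        nlinarith [show 2 ≤ m.natAbs by omega]
      obtain ⟨m', p, hp, rfl⟩ := ih _ hlt (fun h => hw (by simp [h])) hw rfl
      exact ⟨m * m', p, hp, (mul_smul _ _ _).symm⟩

/-- Every nonzero rational vector is a positive multiple of a primitive lattice vector. -/
theorem exists_pos_smul_primitive {x : ℚ ⊗[ℤ] N} (hx : x ≠ 0) :
    ∃ (q : ℚ) (p : N), 0 < q ∧ IsPrimitiveVector p ∧ x = q • ((1 : ℚ) ⊗ₜ[ℤ] p) := by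
  obtain ⟨⟨v, s⟩, hs⟩ := IsLocalizedModule.surj (nonZeroDivisors ℤ) (TensorProduct.mk ℤ ℚ N 1) x
  have hs0 : (s : ℤ) ≠ 0 := nonZeroDivisors.coe_ne_zero s
  have hs' : ((s : ℤ) : ℚ) • x = (1 : ℚ) ⊗ₜ[ℤ] v := by
    rw [Int.cast_smul_eq_zsmul]
    exact hs
  have hsq : ((s : ℤ) : ℚ) ≠ 0 := Int.cast_ne_zero.2 hs0
  have hx' : x = ((s : ℤ) : ℚ)⁻¹ • ((1 : ℚ) ⊗ₜ[ℤ] v) := by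
    rw [← hs', smul_smul, inv_mul_cancel₀ hsq, one_smul]
  obtain ⟨m, p, hp, rfl⟩ := exists_primitive_of_ne_zero (v := v) (by
    rintro rfl
    exact hx (by rw [hx', TensorProduct.tmul_zero, smul_zero]))
  have hx2 : x = (((s : ℤ) : ℚ)⁻¹ * (m : ℚ)) • ((1 : ℚ) ⊗ₜ[ℤ] p) := by
    rw [hx', mul_smul, Int.cast_smul_eq_zsmul, TensorProduct.tmul_smul]
  have hne : ((s : ℤ) : ℚ)⁻¹ * (m : ℚ) ≠ 0 := fun h => hx (by rw [hx2, h, zero_smul])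
  -- A negative sign of the scalar is absorbed into the primitive vector.
  rcases lt_or_gt_of_ne hne with h | h
  · refine ⟨-(((s : ℤ) : ℚ)⁻¹ * (m : ℚ)), -p, neg_pos.2 h, hp.neg, ?_⟩
    rw [TensorProduct.tmul_neg, smul_neg, neg_smul, neg_neg, hx2]
  · exact ⟨_, p, h, hp, hx2⟩

/-- The generators given by `exists_finset_span_eq_of_salient` span one-dimensional faces, and each
is a positive multiple of a primitive vector. Consequently membership in `S_σ` and in `σ^⊥` can be
tested on ray vectors. -/
theorem span_rayVectors {σ : PointedCone ℚ (ℚ ⊗[ℤ] N)} (hσ : IsStronglyConvexPolyhedral σ) :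
    Submodule.span {c : ℚ // 0 ≤ c} ((fun v : N => (1 : ℚ) ⊗ₜ[ℤ] v) '' rayVectors σ) = σ := by
  apply le_antisymm
  · rw [Submodule.span_le]
    rintro _ ⟨v, ⟨-, ρ, hρ, -, hv⟩, rfl⟩
    exact hρ.le hv
  · obtain ⟨G, hG, hray⟩ := exists_finset_span_eq_of_salient hσ.fg hσ.salient
    refine hG.symm.le.trans (Submodule.span_le.2 fun g hg => ?_)
    obtain ⟨hg0, hface⟩ := hray g hg
    obtain ⟨q, p, hq, hp, hgp⟩ := exists_pos_smul_primitive hg0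
    rw [hgp]
    refine Submodule.smul_mem _ (⟨q, hq.le⟩ : {c : ℚ // 0 ≤ c}) (Submodule.subset_span
      ⟨p, ⟨hp, _, hface, ?_, ?_⟩, rfl⟩)
    · have : Submodule.span ℚ ((Submodule.span {c : ℚ // 0 ≤ c} {g} :
          PointedCone ℚ (ℚ ⊗[ℤ] N)) : Set (ℚ ⊗[ℤ] N)) = Submodule.span ℚ {g} :=
        Submodule.span_span_of_tower _ _ _
      rw [coneDim, this, finrank_span_singleton hg0]
    · have : (1 : ℚ) ⊗ₜ[ℤ] p = q⁻¹ • g := by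
        rw [hgp, smul_smul, inv_mul_cancel₀ hq.ne', one_smul]
      rw [this]
      exact Submodule.smul_mem _ (⟨q⁻¹, inv_nonneg.2 hq.le⟩ : {c : ℚ // 0 ≤ c})
        (Submodule.mem_span_singleton_self g)

theorem mem_dualSemigroup_iff {σ : PointedCone ℚ (ℚ ⊗[ℤ] N)} (hσ : IsStronglyConvexPolyhedral σ)
    {u : Module.Dual ℤ N} : u ∈ dualSemigroup σ ↔ ∀ q ∈ rayVectors σ, 0 ≤ u q := by
  conv_lhs => rw [← span_rayVectors hσ]
  rw [mem_dualSemigroup_span, Set.forall_mem_image]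
  simp only [pairing_tmul, one_mul, Int.cast_nonneg_iff]

theorem mem_perpLattice_iff_rayVectors {σ : PointedCone ℚ (ℚ ⊗[ℤ] N)}
    (hσ : IsStronglyConvexPolyhedral σ) {u : Module.Dual ℤ N} :
    u ∈ perpLattice σ ↔ ∀ q ∈ rayVectors σ, u q = 0 := by
  rw [mem_perpLattice_iff, mem_dualSemigroup_iff hσ, mem_dualSemigroup_iff hσ]
  simp only [LinearMap.neg_apply, Left.nonneg_neg_iff]
  exact ⟨fun h q hq => le_antisymm (h.2 q hq) (h.1 q hq),
    fun h => ⟨fun q hq => (h q hq).ge, fun q hq => (h q hq).le⟩⟩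

/-- Every rational functional is a positive rational multiple of a lattice functional. -/
theorem exists_pairing_eq_smul (φ : (ℚ ⊗[ℤ] N) →ₗ[ℚ] ℚ) :
    ∃ (w : Module.Dual ℤ N) (d : ℚ), 0 < d ∧ ∀ x, pairing w x = d * φ x := by
  classical
  let b := Module.Free.chooseBasis ℤ N
  obtain ⟨d, hd⟩ := IsLocalization.exist_integer_multiples_of_finset (nonZeroDivisors ℤ)
    (Finset.univ.image fun i => φ ((1 : ℚ) ⊗ₜ[ℤ] b i))
  have hd0 : (d : ℤ) ≠ 0 := nonZeroDivisors.coe_ne_zero d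
  have hd' : ∀ i, ∃ z : ℤ, (z : ℚ) = (d : ℤ) * φ ((1 : ℚ) ⊗ₜ[ℤ] b i) := by
    intro i
    obtain ⟨z, hz⟩ := hd _ (Finset.mem_image_of_mem _ (Finset.mem_univ i))
    exact ⟨z, by simpa using hz⟩
  choose z hz using hd'
  -- One factor `d` clears the denominators of `φ` on the basis; the second makes the total factor a
  -- square, hence positive whatever the sign of `d`.
  have key : pairing (b.constr ℤ fun i => d * z i) = ((d : ℤ) * (d : ℤ) : ℚ) • φ := by
    refine (b.baseChange ℚ).ext fun i => ?_
    rw [Module.Basis.baseChange_apply, pairing_tmul, Module.Basis.constr_basis]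
    simp [hz, mul_assoc]
  refine ⟨_, _, ?_, fun x => by rw [key]; rfl⟩
  exact mul_self_pos.2 (Int.cast_ne_zero.2 hd0)

/-- The dual semigroup of a face is obtained by inverting one element. -/
theorem exists_dualSemigroup_face_eq {σ τ : PointedCone ℚ (ℚ ⊗[ℤ] N)}
    (hσ : IsStronglyConvexPolyhedral σ) (hτ : τ.IsFaceOf σ) :
    ∃ w ∈ dualSemigroup σ, w ∈ perpLattice τ ∧
      ∀ u ∈ dualSemigroup τ, ∃ n : ℕ, u + n • w ∈ dualSemigroup σ := by
  obtain ⟨φ, hφτ, hφσ, hφ⟩ := exists_dual_eq_zero_on_face hσ.fg hτ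
  obtain ⟨w, d, hd, hw⟩ := exists_pairing_eq_smul φ
  refine ⟨w, fun v hv => by rw [hw]; exact mul_nonneg hd.le (hφσ v hv),
    fun v hv => by rw [hw, hφτ v hv, mul_zero], fun u hu => ?_⟩
  obtain ⟨G, hG⟩ := hσ.fg
  -- On generators in `τ`, `w` vanishes and `u` is nonnegative; on the others `w` is positive.
  -- Finitely many generators allow one large `n` for all.
  have hev : ∀ᶠ n : ℕ in Filter.atTop, ∀ g ∈ G, 0 ≤ pairing u g + n * pairing w g := by
    refine (Filter.eventually_all_finset G).2 fun g hg => ?_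
    have hgσ : g ∈ σ := hG ▸ Submodule.subset_span hg
    by_cases hgτ : g ∈ τ
    · refine Filter.Eventually.of_forall fun n => ?_
      rw [hw, hφτ g hgτ, mul_zero, mul_zero, add_zero]
      exact hu g hgτ
    · have hpos : 0 < pairing w g := by
        rw [hw]
        exact mul_pos hd (lt_of_le_of_ne (hφσ g hgσ) fun h => hgτ (hφ g hgσ h.symm))
      exact (Filter.tendsto_atTop_add_const_left _ _
        (tendsto_natCast_atTop_atTop.atTop_mul_const hpos)).eventually_ge_atTop 0
  obtain ⟨n, hn⟩ := hev.exists
  refine ⟨n, ?_⟩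
  have : u + n • w ∈ dualSemigroup
      (Submodule.span {c : ℚ // 0 ≤ c} (G : Set (ℚ ⊗[ℤ] N)) : PointedCone ℚ (ℚ ⊗[ℤ] N)) := by
    rw [mem_dualSemigroup_span]
    intro g hg
    rw [pairing_add, pairing_nsmul]
    exact hn g hg
  rwa [hG] at this

end Lattice

/-! ### Comultiplications, monoids of points, principal open subsets. -/

section Comultiplication

variable {K : Type*} [Field K] {A : Type*} [CommRing A] [Algebra K A]
  {C : Type*} [CommRing C] [Algebra K C]

theorem tensorMap_injective {A' C' : Type*} [CommRing A'] [Algebra K A'] [CommRing C']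
    [Algebra K C'] {f : A →ₐ[K] C} {g : A' →ₐ[K] C'} (hf : Function.Injective f)
    (hg : Function.Injective g) : Function.Injective (Algebra.TensorProduct.map f g) :=
  TensorProduct.map_injective_of_flat_flat f.toLinearMap g.toLinearMap hf hg

/-- Tensor powers of an injective map over a field are injective, so each axiom may be checked after
applying `ι`, where it is the axiom for `C`. This is how `K[X_σ]` inherits the axioms from the group
`G_χ̄`. -/
theorem IsComultiplication.of_injective {ΔA : A →ₐ[K] A ⊗[K] A} {εA : A →ₐ[K] K}
    {ΔC : C →ₐ[K] C ⊗[K] C} {εC : C →ₐ[K] K} (hC : IsComultiplication ΔC εC)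
    (ι : A →ₐ[K] C) (hι : Function.Injective ι)
    (hΔ : (Algebra.TensorProduct.map ι ι).comp ΔA = ΔC.comp ι) (hε : εC.comp ι = εA) :
    IsComultiplication ΔA εA := by
  have hΔ' : ∀ a, Algebra.TensorProduct.map ι ι (ΔA a) = ΔC (ι a) := fun a => congr($hΔ a)
  constructor
  · ext a
    apply tensorMap_injective hι (tensorMap_injective hι hι)
    have h1 : ∀ z : A ⊗[K] A, Algebra.TensorProduct.map ι (Algebra.TensorProduct.map ι ι)
        (Algebra.TensorProduct.assoc K K K A A A (Algebra.TensorProduct.map ΔA (AlgHom.id K A) z)) =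
        Algebra.TensorProduct.assoc K K K C C C (Algebra.TensorProduct.map ΔC (AlgHom.id K C)
          (Algebra.TensorProduct.map ι ι z)) := by
      have hassoc : ∀ (t : A ⊗[K] A) (y : A), Algebra.TensorProduct.map ι
          (Algebra.TensorProduct.map ι ι) (Algebra.TensorProduct.assoc K K K A A A (t ⊗ₜ y)) =
          Algebra.TensorProduct.assoc K K K C C C (Algebra.TensorProduct.map ι ι t ⊗ₜ ι y) := by
        intro t y
        induction t using TensorProduct.induction_on with
        | zero => simp
        | tmul a b => simp
        | add s t hs ht => simp only [TensorProduct.add_tmul, map_add, hs, ht]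
      intro z
      induction z using TensorProduct.induction_on with
      | zero => simp
      | tmul x y =>
        simp only [Algebra.TensorProduct.map_tmul, AlgHom.id_apply, ← hΔ']
        exact hassoc _ _
      | add s t hs ht => simp only [map_add, hs, ht]
    have h2 : ∀ z : A ⊗[K] A, Algebra.TensorProduct.map ι (Algebra.TensorProduct.map ι ι)
        (Algebra.TensorProduct.map (AlgHom.id K A) ΔA z) =
        Algebra.TensorProduct.map (AlgHom.id K C) ΔC (Algebra.TensorProduct.map ι ι z) := by
      intro z
      induction z using TensorProduct.induction_on with
      | zero => simp
      | tmul x y => simp only [Algebra.TensorProduct.map_tmul, AlgHom.id_apply, ← hΔ']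
      | add s t hs ht => simp only [map_add, hs, ht]
    have h3 := congr($(hC.coassoc) (ι a))
    simp only [AlgHom.comp_apply, ← hΔ'] at h3
    exact (h1 _).trans (h3.trans (h2 _).symm)
  · ext a
    apply hι
    have h1 : ∀ z : A ⊗[K] A, ι (Algebra.TensorProduct.lid K A
        (Algebra.TensorProduct.map εA (AlgHom.id K A) z)) =
        Algebra.TensorProduct.lid K C (Algebra.TensorProduct.map εC (AlgHom.id K C)
          (Algebra.TensorProduct.map ι ι z)) := by
      intro z
      induction z using TensorProduct.induction_on with
      | zero => simp
      | tmul x y => simp [← hε]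
      | add s t hs ht => simp only [map_add, hs, ht]
    have h3 := congr($(hC.counit_left) (ι a))
    simp only [AlgHom.comp_apply, ← hΔ'] at h3
    exact (h1 _).trans h3
  · ext a
    apply hι
    have h1 : ∀ z : A ⊗[K] A, ι (Algebra.TensorProduct.rid K K A
        (Algebra.TensorProduct.map (AlgHom.id K A) εA z)) =
        Algebra.TensorProduct.rid K K C (Algebra.TensorProduct.map (AlgHom.id K C) εC
          (Algebra.TensorProduct.map ι ι z)) := by
      intro z
      induction z using TensorProduct.induction_on with
      | zero => simp
      | tmul x y => simp [← hε]
      | add s t hs ht => simp only [map_add, hs, ht]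
    have h3 := congr($(hC.counit_right) (ι a))
    simp only [AlgHom.comp_apply, ← hΔ'] at h3
    exact (h1 _).trans h3

theorem pointMul_comp {ΔA : A →ₐ[K] A ⊗[K] A} {ΔC : C →ₐ[K] C ⊗[K] C} (ι : A →ₐ[K] C)
    (hΔ : (Algebra.TensorProduct.map ι ι).comp ΔA = ΔC.comp ι) (x y : C →ₐ[K] K) :
    pointMul ΔA (x.comp ι) (y.comp ι) = (pointMul ΔC x y).comp ι := by
  rw [pointMul, pointMul, AlgHom.comp_assoc, ← hΔ, ← AlgHom.comp_assoc]
  congr 1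
  ext <;> simp

/-- The monoid structure on the points of an affine variety whose coordinate algebra carries a
comultiplication. -/
@[reducible]
def pointMonoid {Δ : A →ₐ[K] A ⊗[K] A} {ε : A →ₐ[K] K} (h : IsComultiplication Δ ε) :
    Monoid (A →ₐ[K] K) where
  mul := pointMul Δ
  one := ε
  mul_assoc x y z := by
    change pointMul Δ (pointMul Δ x y) z = pointMul Δ x (pointMul Δ y z)
    -- `m` is evaluation at the triple `(x, y, z)`; the two bracketings are `m` composed with the
    -- two sides of coassociativity.
    let m := Algebra.TensorProduct.lift x
      (Algebra.TensorProduct.lift y z fun _ _ => Commute.all _ _) fun _ _ => Commute.all _ _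
    have h1 : pointMul Δ (pointMul Δ x y) z =
        m.comp ((Algebra.TensorProduct.assoc K K K A A A).toAlgHom.comp
          ((Algebra.TensorProduct.map Δ (AlgHom.id K A)).comp Δ)) := by
      have : Algebra.TensorProduct.lift (pointMul Δ x y) z (fun _ _ => Commute.all _ _) =
          (m.comp (Algebra.TensorProduct.assoc K K K A A A).toAlgHom).comp
            (Algebra.TensorProduct.map Δ (AlgHom.id K A)) := by
        have h3 : Algebra.TensorProduct.lift (Algebra.TensorProduct.lift x y
            fun _ _ => Commute.all _ _) z (fun _ _ => Commute.all _ _) =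
            m.comp (Algebra.TensorProduct.assoc K K K A A A).toAlgHom := by
          ext a
          · simp [m]
          · simp [m]
          · simp [m, Algebra.TensorProduct.one_def]
        rw [← h3]
        ext <;> simp [pointMul]
      rw [pointMul, this]
      rfl
    have h2 : pointMul Δ x (pointMul Δ y z) =
        m.comp ((Algebra.TensorProduct.map (AlgHom.id K A) Δ).comp Δ) := by
      rw [← AlgHom.comp_assoc]
      conv_lhs => rw [pointMul]
      congr 1
      ext <;> simp [m, pointMul]
    rw [h1, h2, h.coassoc]
  one_mul x := by
    change pointMul Δ ε x = x
    have h1 : pointMul Δ ε x = x.comp ((Algebra.TensorProduct.lid K A).toAlgHom.comp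
        ((Algebra.TensorProduct.map ε (AlgHom.id K A)).comp Δ)) := by
      rw [← AlgHom.comp_assoc, ← AlgHom.comp_assoc, pointMul]
      congr 1
      ext <;> simp
    rw [h1, h.counit_left, AlgHom.comp_id]
  mul_one x := by
    change pointMul Δ x ε = x
    have h1 : pointMul Δ x ε = x.comp ((Algebra.TensorProduct.rid K K A).toAlgHom.comp
        ((Algebra.TensorProduct.map (AlgHom.id K A) ε).comp Δ)) := by
      rw [← AlgHom.comp_assoc, ← AlgHom.comp_assoc, pointMul]
      congr 1
      ext <;> simp
    rw [h1, h.counit_right, AlgHom.comp_id]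

theorem isPrincipalOpenEmbedding_of_injective {φ : A →ₐ[K] C} (hφ : Function.Injective φ) {f : A}
    (hf : IsUnit (φ f)) (hsurj : ∀ b, ∃ (n : ℕ) (a : A), b * φ f ^ n = φ a) :
    IsPrincipalOpenEmbedding φ f := by
  let := φ.toRingHom.toAlgebra
  exact IsLocalization.Away.mk f hf hsurj fun a b hab => ⟨0, by rw [hφ hab]⟩

theorem IsPrincipalOpenEmbedding.range_comp {φ : A →ₐ[K] C} {f : A}
    (h : IsPrincipalOpenEmbedding φ f) :
    Set.range (fun y : C →ₐ[K] K => y.comp φ) = {x : A →ₐ[K] K | x f ≠ 0} := by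
  let := φ.toRingHom.toAlgebra
  have : IsLocalization.Away f C := h
  have : IsScalarTower K A C := IsScalarTower.of_algebraMap_eq fun r => (φ.commutes r).symm
  ext x
  constructor
  · rintro ⟨y, rfl⟩
    exact ((IsLocalization.Away.algebraMap_isUnit (S := C) f).map y).ne_zero
  · intro hx
    refine ⟨IsLocalization.Away.liftAlgHom (f := x) f (isUnit_iff_ne_zero.2 hx), ?_⟩
    ext a
    exact IsLocalization.Away.lift_eq (g := x.toRingHom) f (isUnit_iff_ne_zero.2 hx) a

theorem IsPrincipalOpenEmbedding.comp_injective {φ : A →ₐ[K] C} {f : A}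
    (h : IsPrincipalOpenEmbedding φ f) :
    Function.Injective (fun y : C →ₐ[K] K => y.comp φ) := by
  let := φ.toRingHom.toAlgebra
  have : IsLocalization.Away f C := h
  intro x y hxy
  have := IsLocalization.ringHom_ext (Submonoid.powers f) (j := x.toRingHom) (k := y.toRingHom)
    (RingHom.ext fun a => congr($hxy a))
  exact AlgHom.ext fun c => congr($this c)

end Comultiplication

/-! ### The algebraic group `G_χ̄` through its coordinate algebra. -/

section SemidirectProduct

variable (K : Type*) [Field K] {L : Type*} [AddCommGroup L] {k : ℕ}

theorem addMonoidAlgebra_algHom_ext {K : Type*} [Field K] {L : Type*} [AddMonoid L] {B : Type*}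
    [Semiring B] [Algebra K B] {f g : AddMonoidAlgebra K L →ₐ[K] B}
    (h : ∀ m, f (AddMonoidAlgebra.single m 1) = g (AddMonoidAlgebra.single m 1)) : f = g :=
  AddMonoidAlgebra.algHom_ext h (Subsingleton.elim _ _)

/-- The character of the torus `T`, as a regular function on `𝔸^k × T`. -/
def torusChar (k : ℕ) : Multiplicative L →* SemidirectCoordRing K L k :=
  (MvPolynomial.C : AddMonoidAlgebra K L →+* _).toMonoidHom.comp (AddMonoidAlgebra.of K L)

theorem semidirectCoordRing_algHom_ext {K : Type*} [Field K] {L : Type*} [AddCommGroup L] {k : ℕ}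
    {B : Type*} [CommSemiring B] [Algebra K B] {f g : SemidirectCoordRing K L k →ₐ[K] B}
    (hL : ∀ m, f (torusChar K k m) = g (torusChar K k m))
    (hX : ∀ r, f (MvPolynomial.X r) = g (MvPolynomial.X r)) : f = g :=
  MvPolynomial.algHom_ext' (addMonoidAlgebra_algHom_ext fun m => hL (Multiplicative.ofAdd m)) hX

/-- Algebra homomorphisms from the coordinate algebra of `𝔸^k × T`. -/
def semidirectLift {K : Type*} [Field K] {L : Type*} [AddCommGroup L] {k : ℕ}
    {B : Type*} [CommRing B] [Algebra K B] (F : Multiplicative L →* B) (y : Fin k → B) :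
    SemidirectCoordRing K L k →ₐ[K] B :=
  MvPolynomial.aevalTower (AddMonoidAlgebra.lift K B L F) y

@[simp]
theorem semidirectLift_torusChar {B : Type*} [CommRing B] [Algebra K B] (F : Multiplicative L →* B)
    (y : Fin k → B) (m : Multiplicative L) : semidirectLift F y (torusChar K k m) = F m := by
  change MvPolynomial.aevalTower _ _ (MvPolynomial.C (AddMonoidAlgebra.single m.toAdd 1)) = _
  rw [MvPolynomial.aevalTower_C, AddMonoidAlgebra.lift_single, one_smul]
  rfl

@[simp]
theorem semidirectLift_X {B : Type*} [CommRing B] [Algebra K B] (F : Multiplicative L →* B)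
    (y : Fin k → B) (r : Fin k) :
    semidirectLift (K := K) F y (MvPolynomial.X r) = y r :=
  MvPolynomial.aevalTower_X _ _ _

/-- The comultiplication of `G_χ̄`. -/
def semidirectComul (c : Fin k → L) : SemidirectCoordRing K L k →ₐ[K]
    SemidirectCoordRing K L k ⊗[K] SemidirectCoordRing K L k :=
  semidirectLift (B := SemidirectCoordRing K L k ⊗[K] SemidirectCoordRing K L k)
    { toFun := fun m : Multiplicative L => torusChar K k m ⊗ₜ[K] torusChar K k m
      map_one' := by rw [map_one]; rfl
      map_mul' := fun a b => by rw [map_mul, Algebra.TensorProduct.tmul_mul_tmul] }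
    fun r => MvPolynomial.X r ⊗ₜ[K] 1 +
      torusChar K k (Multiplicative.ofAdd (c r)) ⊗ₜ[K] MvPolynomial.X r

@[simp]
theorem semidirectComul_torusChar (c : Fin k → L) (m : Multiplicative L) :
    semidirectComul K c (torusChar K k m) = torusChar K k m ⊗ₜ[K] torusChar K k m :=
  semidirectLift_torusChar _ _ _ _

@[simp]
theorem semidirectComul_X (c : Fin k → L) (r : Fin k) :
    semidirectComul K c (MvPolynomial.X r) = MvPolynomial.X r ⊗ₜ[K] 1 +
      torusChar K k (Multiplicative.ofAdd (c r)) ⊗ₜ[K] MvPolynomial.X r :=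
  semidirectLift_X _ _ _ _

@[simp]
theorem evalAt_torusChar {c : Fin k → L} (g : SemidirectGroup K c) (m : Multiplicative L) :
    evalAt K g (torusChar K k m) = g.right m :=
  semidirectLift_torusChar _ _ _ _

@[simp]
theorem evalAt_X {c : Fin k → L} (g : SemidirectGroup K c) (r : Fin k) :
    evalAt K g (MvPolynomial.X r) = Multiplicative.toAdd g.left r :=
  semidirectLift_X _ _ _ _

theorem isComultiplication_semidirectComul (c : Fin k → L) :
    IsComultiplication (semidirectComul K c) (evalAt K (1 : SemidirectGroup K c)) := by
  constructor
  · refine semidirectCoordRing_algHom_ext (fun m => ?_) fun r => ?_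
    · simp
    · simp [TensorProduct.add_tmul, TensorProduct.tmul_add, add_assoc,
        Algebra.TensorProduct.one_def]
  · refine semidirectCoordRing_algHom_ext (fun m => ?_) fun r => ?_ <;> simp
  · refine semidirectCoordRing_algHom_ext (fun m => ?_) fun r => ?_ <;> simp

theorem pointMul_evalAt {c : Fin k → L} (g h : SemidirectGroup K c) :
    pointMul (semidirectComul K c) (evalAt K g) (evalAt K h) = evalAt K (g * h) := by
  refine semidirectCoordRing_algHom_ext (fun m => ?_) fun r => ?_
  · simp [pointMul]
  · rw [evalAt_X, (semidirectGroup_mul K g h).2]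
    simp [pointMul]

/-- A point of `K[T][α_1, …, α_k]` amounts to the values of the `α_r` and a multiplicative map on
`L`, whose values are automatically units because `L` is a group. -/
theorem evalAt_bijective (c : Fin k → L) :
    Function.Bijective (evalAt K : SemidirectGroup K c → _) := by
  constructor
  · intro g h hgh
    refine SemidirectProduct.ext ?_ ?_
    · refine Multiplicative.toAdd.injective (funext fun r => ?_)
      rw [← evalAt_X, hgh, evalAt_X]
    · refine MonoidHom.ext fun m => Units.ext ?_
      rw [← evalAt_torusChar, hgh, evalAt_torusChar]
  · intro y
    refine ⟨⟨Multiplicative.ofAdd fun r => y (MvPolynomial.X r),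
      ((y : _ →* K).comp (torusChar K k)).toHomUnits⟩, ?_⟩
    refine semidirectCoordRing_algHom_ext (fun m => ?_) fun r => ?_
    · rw [evalAt_torusChar]
      rfl
    · rw [evalAt_X]
      rfl

end SemidirectProduct

/-! ### Coordinates on `X_τ` and the comultiplication on `X_σ`. -/

section Toric

variable {K : Type*} [Field K] {N : Type*} [AddCommGroup N] {k : ℕ}
  {σ τ : PointedCone ℚ (ℚ ⊗[ℤ] N)} {p : Fin k → N} {e e' : Fin k → Module.Dual ℤ N}

/-- `p` lists the rays of the regular cone `τ`, and `-e` is a system of functionals dual to `p`. -/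
structure IsDualFrame (τ : PointedCone ℚ (ℚ ⊗[ℤ] N)) (p : Fin k → N)
    (e : Fin k → Module.Dual ℤ N) : Prop where
  mem_dualSemigroup : ∀ u : Module.Dual ℤ N, u ∈ dualSemigroup τ ↔ ∀ r, 0 ≤ u (p r)
  mem_perpLattice : ∀ u : Module.Dual ℤ N, u ∈ perpLattice τ ↔ ∀ r, u (p r) = 0
  apply_eq : ∀ r s, e r (p s) = if r = s then -1 else 0

theorem chi_eq_of (u : Module.Dual ℤ N) :
    chi K u = AddMonoidAlgebra.of K (Module.Dual ℤ N) (Multiplicative.ofAdd u) := rfl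

theorem chi_add (u v : Module.Dual ℤ N) : chi K (u + v) = chi K u * chi K v := by
  simp only [chi_eq_of, ofAdd_add, map_mul]

theorem chi_zero : chi K (0 : Module.Dual ℤ N) = 1 := rfl

theorem inclM_injective : Function.Injective (inclM K σ) :=
  AddMonoidAlgebra.mapDomain_injective Subtype.val_injective

theorem restrictHom_injective (h : τ ≤ σ) : Function.Injective (restrictHom K h) :=
  AddMonoidAlgebra.mapDomain_injective (AddSubmonoid.inclusion_injective _)

@[simp]
theorem inclM_single (u : dualSemigroup σ) : inclM K σ (AddMonoidAlgebra.single u 1) = chi K u :=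
  AddMonoidAlgebra.mapDomain_single

@[simp]
theorem restrictHom_single (h : τ ≤ σ) (u : dualSemigroup σ) :
    restrictHom K h (AddMonoidAlgebra.single u 1) =
      AddMonoidAlgebra.single (AddSubmonoid.inclusion (dualSemigroup_anti h) u) 1 :=
  AddMonoidAlgebra.mapDomain_single

/-- The projection of `M` to `τ^⊥` along the span of `e`. -/
def perpPart (p : Fin k → N) (e : Fin k → Module.Dual ℤ N) (u : Module.Dual ℤ N) :
    Module.Dual ℤ N :=
  u + ∑ r, u (p r) • e r

theorem perpPart_add (u v : Module.Dual ℤ N) :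
    perpPart p e (u + v) = perpPart p e u + perpPart p e v := by
  simp only [perpPart, LinearMap.add_apply, add_smul, Finset.sum_add_distrib]
  abel

theorem perpPart_of_forall_eq_zero {u : Module.Dual ℤ N} (h : ∀ r, u (p r) = 0) :
    perpPart p e u = u := by
  simp [perpPart, h]

namespace IsDualFrame

theorem perpPart_mem (h : IsDualFrame τ p e) (u : Module.Dual ℤ N) :
    perpPart p e u ∈ perpLattice τ := by
  rw [h.mem_perpLattice]
  intro s
  simp [perpPart, h.apply_eq]

theorem perpPart_neg (h : IsDualFrame τ p e) (r : Fin k) : perpPart p e (-e r) = 0 := by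
  simp [perpPart, h.apply_eq]

theorem neg_mem (h : IsDualFrame τ p e) (r : Fin k) : -e r ∈ dualSemigroup τ := by
  rw [h.mem_dualSemigroup]
  intro s
  rw [LinearMap.neg_apply, h.apply_eq]
  split_ifs <;> simp

theorem sub_mem (h : IsDualFrame τ p e) (h' : IsDualFrame τ p e') (r : Fin k) :
    e' r - e r ∈ perpLattice τ := by
  rw [h.mem_perpLattice]
  intro s
  rw [LinearMap.sub_apply, h.apply_eq, h'.apply_eq, sub_self]

/-- By definition of `perpPart`, `u` is its projection plus `∑ u (p r) • (-e r)`, with nonnegative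
coefficients. A general multiplicative `F` serves both `χ^u` and `χ^u ⊗ χ^u`. -/
theorem map_decomp (h : IsDualFrame τ p e) {B : Type*} [CommMonoid B]
    (F : Multiplicative (Module.Dual ℤ N) →* B) {u : Module.Dual ℤ N} (hu : u ∈ dualSemigroup τ) :
    F (Multiplicative.ofAdd (perpPart p e u)) *
      ∏ r, F (Multiplicative.ofAdd (-e r)) ^ (u (p r)).toNat = F (Multiplicative.ofAdd u) := by
  rw [← Finset.prod_congr rfl fun r _ => map_pow F _ _, ← map_prod, ← map_mul]
  congr 1
  apply Multiplicative.toAdd.injective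
  rw [toAdd_mul, toAdd_prod]
  simp only [toAdd_pow, toAdd_ofAdd, perpPart, smul_neg, Finset.sum_neg_distrib]
  rw [Finset.sum_congr rfl fun r _ => ?_, add_neg_cancel_right]
  rw [← natCast_zsmul, Int.toNat_of_nonneg ((h.mem_dualSemigroup u).1 hu r)]

variable (K)

/-- The monomial of `K[T][α_1, …, α_k]` corresponding to `χ^u`, `u ∈ S_τ`. -/
def semidirectMonomial (h : IsDualFrame τ p e) :
    Multiplicative (dualSemigroup τ) →* SemidirectCoordRing K (perpLattice τ) k where
  toFun u := torusChar K k (Multiplicative.ofAdd ⟨perpPart p e u.toAdd, h.perpPart_mem _⟩) *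
    ∏ r, MvPolynomial.X r ^ ((u.toAdd : Module.Dual ℤ N) (p r)).toNat
  map_one' := by
    have : (⟨perpPart p e 0, h.perpPart_mem _⟩ : perpLattice τ) = 0 :=
      Subtype.ext (perpPart_of_forall_eq_zero fun _ => rfl)
    simp [this]
  map_mul' u v := by
    have h1 : (⟨perpPart p e (u * v).toAdd, h.perpPart_mem _⟩ : perpLattice τ) =
        ⟨perpPart p e u.toAdd, h.perpPart_mem _⟩ + ⟨perpPart p e v.toAdd, h.perpPart_mem _⟩ :=
      Subtype.ext (perpPart_add _ _)
    have h2 : ∀ r, (((u * v).toAdd : Module.Dual ℤ N) (p r)).toNat =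
        ((u.toAdd : Module.Dual ℤ N) (p r)).toNat + ((v.toAdd : Module.Dual ℤ N) (p r)).toNat :=
      fun r => Int.toNat_add ((h.mem_dualSemigroup _).1 u.toAdd.2 r)
        ((h.mem_dualSemigroup _).1 v.toAdd.2 r)
    simp only [h1, h2, ofAdd_add, map_mul, pow_add, Finset.prod_mul_distrib]
    ring

/-- The homomorphism `K[X_τ] → K[T][α_1, …, α_k]`. -/
def toSemidirect (h : IsDualFrame τ p e) :
    CoordRing K τ →ₐ[K] SemidirectCoordRing K (perpLattice τ) k :=
  AddMonoidAlgebra.lift K _ _ (h.semidirectMonomial K)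

theorem toSemidirect_single (h : IsDualFrame τ p e) (u : dualSemigroup τ) :
    h.toSemidirect K (AddMonoidAlgebra.single u 1) =
      torusChar K k (Multiplicative.ofAdd ⟨perpPart p e u, h.perpPart_mem _⟩) *
        ∏ r, MvPolynomial.X r ^ ((u : Module.Dual ℤ N) (p r)).toNat := by
  rw [toSemidirect, AddMonoidAlgebra.lift_single, one_smul]
  rfl

/-- The homomorphism `K[T][α_1, …, α_k] → K[X_τ]`, `α_r ↦ χ^{-e_r}`. -/
def fromSemidirect (h : IsDualFrame τ p e) :
    SemidirectCoordRing K (perpLattice τ) k →ₐ[K] CoordRing K τ :=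
  semidirectLift
    ((AddMonoidAlgebra.of K (dualSemigroup τ)).comp (AddMonoidHom.toMultiplicative
      { toFun := fun m : perpLattice τ => (⟨m, (mem_perpLattice_iff.1 m.2).1⟩ : dualSemigroup τ)
        map_zero' := rfl
        map_add' := fun _ _ => rfl }))
    fun r => AddMonoidAlgebra.single ⟨-e r, h.neg_mem r⟩ 1

/-- The embedding `K[T][α_1, …, α_k] → K[M]`. -/
def semidirectToLaurent (h : IsDualFrame τ p e) :
    SemidirectCoordRing K (perpLattice τ) k →ₐ[K] AddMonoidAlgebra K (Module.Dual ℤ N) :=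
  (inclM K τ).comp (h.fromSemidirect K)

@[simp]
theorem semidirectToLaurent_torusChar (h : IsDualFrame τ p e)
    (m : Multiplicative (perpLattice τ)) :
    h.semidirectToLaurent K (torusChar K k m) = chi K m.toAdd := by
  rw [semidirectToLaurent, AlgHom.comp_apply, fromSemidirect, semidirectLift_torusChar]
  exact inclM_single _

@[simp]
theorem semidirectToLaurent_X (h : IsDualFrame τ p e) (r : Fin k) :
    h.semidirectToLaurent K (MvPolynomial.X r) = chi K (-e r) := by
  rw [semidirectToLaurent, AlgHom.comp_apply, fromSemidirect, semidirectLift_X, inclM_single]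

theorem semidirectToLaurent_comp_toSemidirect (h : IsDualFrame τ p e) :
    (h.semidirectToLaurent K).comp (h.toSemidirect K) = inclM K τ := by
  refine addMonoidAlgebra_algHom_ext fun u => ?_
  rw [AlgHom.comp_apply, toSemidirect_single, map_mul, map_prod, inclM_single]
  simp only [map_pow, semidirectToLaurent_torusChar, semidirectToLaurent_X]
  exact h.map_decomp (AddMonoidAlgebra.of K _) u.2

theorem toSemidirect_comp_fromSemidirect (h : IsDualFrame τ p e) :
    (h.toSemidirect K).comp (h.fromSemidirect K) = AlgHom.id K _ := by
  refine semidirectCoordRing_algHom_ext (fun m => ?_) fun r => ?_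
  · rw [AlgHom.comp_apply, fromSemidirect, semidirectLift_torusChar]
    refine (h.toSemidirect_single K _).trans ?_
    have hm : ∀ r, (m.toAdd : Module.Dual ℤ N) (p r) = 0 := (h.mem_perpLattice _).1 m.toAdd.2
    have : (⟨perpPart p e m.toAdd, h.perpPart_mem _⟩ : perpLattice τ) = m.toAdd :=
      Subtype.ext (perpPart_of_forall_eq_zero hm)
    simp [this, hm]
  · rw [AlgHom.comp_apply, fromSemidirect, semidirectLift_X, toSemidirect_single]
    have : (⟨perpPart p e (-e r), h.perpPart_mem _⟩ : perpLattice τ) = 0 :=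
      Subtype.ext (h.perpPart_neg r)
    simp only [this, LinearMap.neg_apply, h.apply_eq, ofAdd_zero, map_one, one_mul]
    rw [Finset.prod_eq_single r (fun s _ hs => by simp [Ne.symm hs]) (by simp)]
    simp

/-- The isomorphism of the coordinate algebras of `X_τ` and `𝔸^k × T`. -/
def semidirectEquiv (h : IsDualFrame τ p e) :
    CoordRing K τ ≃ₐ[K] SemidirectCoordRing K (perpLattice τ) k :=
  AlgEquiv.ofAlgHom (h.toSemidirect K) (h.fromSemidirect K) (h.toSemidirect_comp_fromSemidirect K)
    (by
      -- This composite is compared with the identity inside `K[M]`, where both are the inclusion.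
      refine AlgHom.ext fun a => inclM_injective ?_
      exact congr($(h.semidirectToLaurent_comp_toSemidirect K) a))

theorem semidirectToLaurent_injective (h : IsDualFrame τ p e) :
    Function.Injective (h.semidirectToLaurent K) :=
  inclM_injective.comp (h.semidirectEquiv K).symm.injective

/-- The differences `e'_r - e_r`, as characters of the torus with character lattice `M(τ)`. -/
def charDiff (h : IsDualFrame τ p e) (h' : IsDualFrame τ p e') (r : Fin k) : perpLattice τ :=
  ⟨e' r - e r, h.sub_mem h' r⟩

/-- The restriction of regular functions from `X_σ` to `X_τ ≅ 𝔸^k × T`. -/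
def restrictToSemidirect (h : IsDualFrame τ p e) (hle : τ ≤ σ) :
    CoordRing K σ →ₐ[K] SemidirectCoordRing K (perpLattice τ) k :=
  (h.toSemidirect K).comp (restrictHom K hle)

theorem restrictToSemidirect_injective (h : IsDualFrame τ p e) (hle : τ ≤ σ) :
    Function.Injective (h.restrictToSemidirect K hle) :=
  (h.semidirectEquiv K).injective.comp (restrictHom_injective hle)

theorem semidirectToLaurent_comp_restrict (h : IsDualFrame τ p e) (hle : τ ≤ σ) :
    (h.semidirectToLaurent K).comp (h.restrictToSemidirect K hle) = inclM K σ := by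
  rw [restrictToSemidirect, ← AlgHom.comp_assoc, semidirectToLaurent_comp_toSemidirect]
  refine addMonoidAlgebra_algHom_ext fun u => ?_
  simp

/-- The point is the factorization `hfac`: extracting `χ^{-e r} ⊗ χ^{-e r}` from the image of each
`α_r` leaves the binomial of the formula, and the extracted factors, together with that of the torus
part, multiply to `χ^u ⊗ χ^u`. -/
theorem comul_restrictToSemidirect_single (h : IsDualFrame τ p e) (h' : IsDualFrame τ p e')
    (hle : τ ≤ σ) (u : dualSemigroup σ) :
    Algebra.TensorProduct.map (h.semidirectToLaurent K) (h.semidirectToLaurent K)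
      (semidirectComul K (h.charDiff h') (h.restrictToSemidirect K hle (chiS K u))) =
      (chi K (u : Module.Dual ℤ N) ⊗ₜ[K] chi K u) *
        ∏ r : Fin k, (1 ⊗ₜ[K] chi K (e r) +
          chi K (e' r) ⊗ₜ[K] 1) ^ ((u : Module.Dual ℤ N) (p r)).toNat := by
  let D : Multiplicative (Module.Dual ℤ N) →*
      AddMonoidAlgebra K (Module.Dual ℤ N) ⊗[K] AddMonoidAlgebra K (Module.Dual ℤ N) :=
    { toFun := fun m => chi K m.toAdd ⊗ₜ[K] chi K m.toAdd
      map_one' := rfl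
      map_mul' := fun a b => by
        rw [toAdd_mul, chi_add, Algebra.TensorProduct.tmul_mul_tmul] }
  have hfac : ∀ r, chi K (-e r) ⊗ₜ[K] 1 + chi K (e' r - e r) ⊗ₜ[K] chi K (-e r) =
      D (Multiplicative.ofAdd (-e r)) * (1 ⊗ₜ[K] chi K (e r) + chi K (e' r) ⊗ₜ[K] 1) := by
    intro r
    change _ = (chi K (-e r) ⊗ₜ[K] chi K (-e r)) * _
    rw [mul_add, Algebra.TensorProduct.tmul_mul_tmul, Algebra.TensorProduct.tmul_mul_tmul,
      ← chi_add, ← chi_add, mul_one, neg_add_cancel, chi_zero, neg_add_eq_sub]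
  rw [restrictToSemidirect, AlgHom.comp_apply, chiS, restrictHom_single, toSemidirect_single]
  simp only [map_mul, map_prod, map_pow, semidirectComul_torusChar, semidirectComul_X, map_add,
    Algebra.TensorProduct.map_tmul, semidirectToLaurent_torusChar, semidirectToLaurent_X, map_one,
    toAdd_ofAdd, charDiff, hfac, mul_pow, Finset.prod_mul_distrib]
  rw [← mul_assoc]
  congr 1
  exact h.map_decomp D (dualSemigroup_anti hle u.2)

end IsDualFrame

/-- Expanding one factor `r` adds `e r` to the right exponent or `e' r` to the left one, lowering
its value on `p r` by one and leaving the other `p s` alone. The two exponents thus evolve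
separately, which forces independent `u` and `v`; the count bounds keep them positive on `p r`
whenever a factor `r` remains. -/
theorem mul_prod_mem_range (hS : ∀ u : Module.Dual ℤ N, u ∈ dualSemigroup σ → ∀ r, 0 < u (p r) →
      u + e r ∈ dualSemigroup σ ∧ u + e' r ∈ dualSemigroup σ)
    (he : ∀ r s, e r (p s) = if r = s then -1 else 0)
    (he' : ∀ r s, e' r (p s) = if r = s then -1 else 0)
    (m : Multiset (Fin k)) {u v : Module.Dual ℤ N} (hu : u ∈ dualSemigroup σ)
    (hv : v ∈ dualSemigroup σ) (hum : ∀ r, (m.count r : ℤ) ≤ u (p r))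
    (hvm : ∀ r, (m.count r : ℤ) ≤ v (p r)) :
    (chi K u ⊗ₜ[K] chi K v) * (m.map fun r => 1 ⊗ₜ[K] chi K (e r) + chi K (e' r) ⊗ₜ[K] 1).prod ∈
      (Algebra.TensorProduct.map (inclM K σ) (inclM K σ)).range := by
  induction m using Multiset.induction_on generalizing u v with
  | empty =>
    refine ⟨chiS K ⟨u, hu⟩ ⊗ₜ[K] chiS K ⟨v, hv⟩, ?_⟩
    simp [chiS]
  | cons a m ih =>
    have hcount : ∀ r, ((a ::ₘ m).count r : ℤ) = m.count r + if a = r then 1 else 0 := by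
      intro r
      rw [Multiset.count_cons]
      simp [eq_comm]
    have hle : ∀ {w : Module.Dual ℤ N}, (∀ r, ((a ::ₘ m).count r : ℤ) ≤ w (p r)) →
        0 < w (p a) ∧ ∀ r, (m.count r : ℤ) ≤ w (p r) := by
      intro w hw
      have ha := hw a
      rw [hcount, if_pos rfl] at ha
      refine ⟨by omega, fun r => le_trans ?_ (hw r)⟩
      rw [hcount]
      split_ifs <;> omega
    have hadd : ∀ {w f : Module.Dual ℤ N}, (∀ r, ((a ::ₘ m).count r : ℤ) ≤ w (p r)) →
        (∀ s, f (p s) = if a = s then -1 else 0) → ∀ r, (m.count r : ℤ) ≤ (w + f) (p r) := by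
      intro w f hw hf r
      have := hw r
      rw [hcount] at this
      rw [LinearMap.add_apply, hf]
      split_ifs at this ⊢ <;> omega
    rw [Multiset.map_cons, Multiset.prod_cons, ← mul_assoc, mul_add,
      Algebra.TensorProduct.tmul_mul_tmul, Algebra.TensorProduct.tmul_mul_tmul, mul_one, mul_one,
      ← chi_add, ← chi_add, add_mul]
    exact add_mem (ih hu (hS v hv a (hle hvm).1).1 (hle hum).2 (hadd hvm (he a)))
      (ih (hS u hu a (hle hum).1).2 hv (hadd hum (he' a)) (hle hvm).2)

theorem exists_algHom_comp_eq {A B C : Type*} [CommRing A] [CommRing B] [CommRing C] [Algebra K A]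
    [Algebra K B] [Algebra K C] (g : B →ₐ[K] C) (hg : Function.Injective g) (f : A →ₐ[K] C)
    (h : ∀ a, f a ∈ g.range) : ∃ l : A →ₐ[K] B, g.comp l = f := by
  refine ⟨(AlgEquiv.ofInjective g hg).symm.toAlgHom.comp (f.codRestrict g.range h), ?_⟩
  ext a
  exact congrArg Subtype.val ((AlgEquiv.ofInjective g hg).apply_symm_apply ⟨f a, h a⟩)

theorem coordRing_induction {P : CoordRing K σ → Prop} (hchi : ∀ u, P (chiS K u))
    (hadd : ∀ a b, P a → P b → P (a + b)) (hsmul : ∀ (t : K) a, P a → P (t • a)) (a) : P a :=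
  AddMonoidAlgebra.induction_on a hchi hadd hsmul

/-- The comultiplication of `X_τ ≅ 𝔸^k × T` restricts to `K[X_σ]`. -/
theorem exists_comul (h : IsDualFrame τ p e) (h' : IsDualFrame τ p e') (hle : τ ≤ σ)
    (hS : ∀ u : Module.Dual ℤ N, u ∈ dualSemigroup σ → ∀ r, 0 < u (p r) →
      u + e r ∈ dualSemigroup σ ∧ u + e' r ∈ dualSemigroup σ) :
    ∃ Δ : CoordRing K σ →ₐ[K] CoordRing K σ ⊗[K] CoordRing K σ,
      (Algebra.TensorProduct.map (h.restrictToSemidirect K hle)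
        (h.restrictToSemidirect K hle)).comp Δ =
        (semidirectComul K (h.charDiff h')).comp (h.restrictToSemidirect K hle) := by
  have hcomp : (Algebra.TensorProduct.map (h.semidirectToLaurent K)
      (h.semidirectToLaurent K)).comp (Algebra.TensorProduct.map (h.restrictToSemidirect K hle)
        (h.restrictToSemidirect K hle)) =
      Algebra.TensorProduct.map (inclM K σ) (inclM K σ) := by
    rw [← Algebra.TensorProduct.map_comp, h.semidirectToLaurent_comp_restrict K hle]
  obtain ⟨Δ, hΔ⟩ := exists_algHom_comp_eq
    (Algebra.TensorProduct.map (inclM K σ) (inclM K σ))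
    (tensorMap_injective inclM_injective inclM_injective)
    ((Algebra.TensorProduct.map (h.semidirectToLaurent K) (h.semidirectToLaurent K)).comp
      ((semidirectComul K (h.charDiff h')).comp (h.restrictToSemidirect K hle))) (by
    refine coordRing_induction (fun u => ?_) (fun a b ha hb => ?_) fun t a ha => ?_
    · rw [AlgHom.comp_apply, AlgHom.comp_apply, h.comul_restrictToSemidirect_single K h' hle]
      have hu : ∀ r, 0 ≤ (u : Module.Dual ℤ N) (p r) :=
        (h.mem_dualSemigroup _).1 (dualSemigroup_anti hle u.2)
      -- Each index `r` is repeated `u (p r)` times, turning the product of powers into a product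
      -- over a multiset.
      let m : Multiset (Fin k) := Finsupp.toMultiset
        (Finsupp.equivFunOnFinite.symm fun r => ((u : Module.Dual ℤ N) (p r)).toNat)
      have hm : ∀ r, m.count r = ((u : Module.Dual ℤ N) (p r)).toNat :=
        fun r => Finsupp.count_toMultiset _ _
      have hm' : ∀ r, (m.count r : ℤ) ≤ (u : Module.Dual ℤ N) (p r) := fun r => by
        rw [hm, Int.toNat_of_nonneg (hu r)]
      have key := mul_prod_mem_range (K := K) hS h.apply_eq h'.apply_eq m u.2 u.2 hm' hm'
      rw [Finset.prod_multiset_map_count, Finset.prod_subset (Finset.subset_univ _)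
        fun r _ hr => by rw [Multiset.count_eq_zero_of_notMem (by simpa using hr), pow_zero]] at key
      simpa only [hm] using key
    · rw [map_add]
      exact add_mem ha hb
    · rw [map_smul]
      exact Subalgebra.smul_mem _ ha t)
  refine ⟨Δ, AlgHom.ext fun a => ?_⟩
  apply tensorMap_injective (h.semidirectToLaurent_injective K) (h.semidirectToLaurent_injective K)
  refine Eq.trans ?_ (congr($hΔ a))
  exact congr($hcomp (Δ a))

end Toric

/-! ### Points of `X_σ` and the embedding of `G_χ̄`. -/

section Units

variable {K : Type*} [Field K] {N : Type*} [AddCommGroup N] {k : ℕ}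
  {σ τ : PointedCone ℚ (ℚ ⊗[ℤ] N)} {p : Fin k → N} {e e' : Fin k → Module.Dual ℤ N}

theorem distinguishedPoint_single_of_mem (hle : τ ≤ σ) {u : dualSemigroup σ}
    (hu : (u : Module.Dual ℤ N) ∈ perpLattice τ) :
    distinguishedPoint K hle (AddMonoidAlgebra.single u 1) = 1 := by
  rw [distinguishedPoint, AddMonoidAlgebra.lift_single, one_smul]
  exact if_pos hu

theorem distinguishedPoint_single_of_notMem (hle : τ ≤ σ) {u : dualSemigroup σ}
    (hu : (u : Module.Dual ℤ N) ∉ perpLattice τ) :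
    distinguishedPoint K hle (AddMonoidAlgebra.single u 1) = 0 := by
  rw [distinguishedPoint, AddMonoidAlgebra.lift_single, one_smul]
  exact if_neg hu

/-- At `α = 0`, `t = 1` the monomial of `u` takes the value `∏ 0 ^ u (p r)`; since `0 ^ 0 = 1`, this
is `1` exactly when `u` vanishes on all `p r`. -/
theorem IsDualFrame.evalAt_one_comp (h : IsDualFrame τ p e) (hle : τ ≤ σ)
    (c : Fin k → perpLattice τ) :
    (evalAt K (1 : SemidirectGroup K c)).comp (h.restrictToSemidirect K hle) =
      distinguishedPoint K hle := by
  refine addMonoidAlgebra_algHom_ext fun u => ?_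
  rw [restrictToSemidirect, AlgHom.comp_apply, AlgHom.comp_apply, restrictHom_single,
    toSemidirect_single, map_mul, evalAt_torusChar, map_prod]
  simp only [map_pow, evalAt_X, SemidirectProduct.one_right, MonoidHom.one_apply, Units.val_one,
    one_mul, SemidirectProduct.one_left, toAdd_one, Pi.zero_apply, AddSubmonoid.coe_inclusion]
  by_cases hu : (u : Module.Dual ℤ N) ∈ perpLattice τ
  · rw [distinguishedPoint_single_of_mem hle hu]
    refine Finset.prod_eq_one fun r _ => ?_
    rw [(h.mem_perpLattice _).1 hu r, Int.toNat_zero, pow_zero]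
  · rw [distinguishedPoint_single_of_notMem hle hu]
    rw [h.mem_perpLattice, not_forall] at hu
    obtain ⟨r, hr⟩ := hu
    have := (h.mem_dualSemigroup _).1 (dualSemigroup_anti hle u.2) r
    exact Finset.prod_eq_zero (Finset.mem_univ r) (zero_pow (by omega))

/-- If `S_τ = S_σ - ℕ w`, then `X_τ ⊆ X_σ` is the principal open subset `χ^w ≠ 0`. -/
theorem isPrincipalOpenEmbedding_restrictHom (hle : τ ≤ σ) {w : Module.Dual ℤ N}
    (hw : w ∈ dualSemigroup σ) (hwτ : w ∈ perpLattice τ)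
    (h : ∀ u ∈ dualSemigroup τ, ∃ n : ℕ, u + n • w ∈ dualSemigroup σ) :
    IsPrincipalOpenEmbedding (restrictHom K hle) (chiS K ⟨w, hw⟩) := by
  have hpow : ∀ n : ℕ, restrictHom K hle (chiS K ⟨w, hw⟩) ^ n =
      AddMonoidAlgebra.single (n • ⟨w, dualSemigroup_anti hle hw⟩) 1 := by
    intro n
    rw [chiS, restrictHom_single, AddMonoidAlgebra.single_pow, one_pow]
    rfl
  refine isPrincipalOpenEmbedding_of_injective (restrictHom_injective hle) ?_ ?_
  · refine IsUnit.of_mul_eq_one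
      (AddMonoidAlgebra.single ⟨-w, (mem_perpLattice_iff.1 hwτ).2⟩ 1) ?_
    rw [chiS, restrictHom_single, AddMonoidAlgebra.single_mul_single, mul_one,
      AddMonoidAlgebra.one_def]
    congr 1
    exact Subtype.ext (add_neg_cancel w)
  · refine coordRing_induction (fun u => ?_) (fun a b ha hb => ?_) fun t a ha => ?_
    · obtain ⟨n, hn⟩ := h u u.2
      refine ⟨n, chiS K ⟨_, hn⟩, ?_⟩
      rw [hpow, chiS, chiS, restrictHom_single, AddMonoidAlgebra.single_mul_single, mul_one]
      congr 1
    · obtain ⟨n, x, hx⟩ := ha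
      obtain ⟨m, y, hy⟩ := hb
      refine ⟨n + m, x * chiS K ⟨w, hw⟩ ^ m + y * chiS K ⟨w, hw⟩ ^ n, ?_⟩
      rw [map_add, map_mul, map_mul, map_pow, map_pow, ← hx, ← hy, pow_add]
      ring
    · obtain ⟨n, x, hx⟩ := ha
      exact ⟨n, t • x, by rw [map_smul, ← hx, smul_mul_assoc]⟩

/-- A point invertible with respect to a comultiplication does not vanish at a group-like element
on which the counit takes the value `1`. -/
theorem apply_ne_zero_of_pointMul_eq {A : Type*} [CommRing A] [Algebra K A]
    {Δ : A →ₐ[K] A ⊗[K] A} {f : A} (hf : Δ f = f ⊗ₜ[K] f) {x y ε : A →ₐ[K] K}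
    (hxy : pointMul Δ x y = ε) (hε : ε f = 1) : x f ≠ 0 := by
  intro h0
  have : pointMul Δ x y f = x f * y f := by
    rw [pointMul, AlgHom.comp_apply, hf, Algebra.TensorProduct.lift_tmul]
  rw [hxy, hε, h0, zero_mul] at this
  exact one_ne_zero this

/-- For `u ∈ τ^⊥` no `α_r` occurs in the monomial of `u`, so it is a character of the torus, hence
group-like. -/
theorem IsDualFrame.comul_chiS_of_mem (h : IsDualFrame τ p e) (hle : τ ≤ σ)
    {c : Fin k → perpLattice τ} {Δ : CoordRing K σ →ₐ[K] CoordRing K σ ⊗[K] CoordRing K σ}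
    (hΔ : (Algebra.TensorProduct.map (h.restrictToSemidirect K hle)
        (h.restrictToSemidirect K hle)).comp Δ =
        (semidirectComul K c).comp (h.restrictToSemidirect K hle))
    {u : dualSemigroup σ} (hu : (u : Module.Dual ℤ N) ∈ perpLattice τ) :
    Δ (chiS K u) = chiS K u ⊗ₜ[K] chiS K u := by
  apply tensorMap_injective (h.restrictToSemidirect_injective K hle)
    (h.restrictToSemidirect_injective K hle)
  refine congr($hΔ (chiS K u)).trans ?_
  have h0 : ∀ r, (u : Module.Dual ℤ N) (p r) = 0 := (h.mem_perpLattice _).1 hu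
  have : h.restrictToSemidirect K hle (chiS K u) =
      torusChar K k (Multiplicative.ofAdd ⟨_, h.perpPart_mem u⟩) := by
    rw [restrictToSemidirect, AlgHom.comp_apply, chiS, restrictHom_single, toSemidirect_single]
    simp [h0]
  rw [AlgHom.comp_apply, Algebra.TensorProduct.map_tmul, this, semidirectComul_torusChar]

/-- The embedding of the group `G_χ̄` into `X_σ`. -/
def IsDualFrame.toPoint (h : IsDualFrame τ p e) (hle : τ ≤ σ) {c : Fin k → perpLattice τ}
    (g : SemidirectGroup K c) : ToricVariety K σ :=
  (evalAt K g).comp (h.restrictToSemidirect K hle)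

theorem IsDualFrame.range_toPoint (h : IsDualFrame τ p e) (hle : τ ≤ σ)
    (c : Fin k → perpLattice τ) :
    Set.range (h.toPoint hle : SemidirectGroup K c → _) = toricSubset K hle := by
  apply Set.Subset.antisymm
  · rintro _ ⟨g, rfl⟩
    exact ⟨(evalAt K g).comp (h.toSemidirect K), rfl⟩
  · rintro _ ⟨y, rfl⟩
    obtain ⟨g, hg⟩ := (evalAt_bijective K c).2 (y.comp (h.fromSemidirect K))
    refine ⟨g, AlgHom.ext fun a => ?_⟩
    exact congr($hg _).trans (congrArg y ((h.semidirectEquiv K).symm_apply_apply _))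

theorem IsDualFrame.toPoint_injective (h : IsDualFrame τ p e) (hle : τ ≤ σ)
    (c : Fin k → perpLattice τ) {f : CoordRing K σ}
    (hf : IsPrincipalOpenEmbedding (restrictHom K hle) f) :
    Function.Injective (h.toPoint hle : SemidirectGroup K c → _) := by
  intro g g' hgg
  apply (evalAt_bijective K c).1
  have hcomp : (evalAt K g).comp (h.toSemidirect K) = (evalAt K g').comp (h.toSemidirect K) :=
    hf.comp_injective hgg
  exact (AlgHom.cancel_right (h.semidirectEquiv K).surjective).1 hcomp

theorem linearMap_eq_iff_forall_chiS {E : Type*} [AddCommGroup E] [Module K E]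
    {f g : CoordRing K σ →ₗ[K] E} : f = g ↔ ∀ u, f (chiS K u) = g (chiS K u) := by
  refine ⟨fun h _ => h ▸ rfl, fun h => LinearMap.ext ?_⟩
  exact coordRing_induction h (fun a b ha hb => by rw [map_add, map_add, ha, hb])
    fun t a ha => by rw [map_smul, map_smul, ha]

end Units

/-! ### Dual frames from ray vectors, and translation by Demazure roots. -/

section Cones

variable {N : Type*} [AddCommGroup N] [Module.Free ℤ N] [Module.Finite ℤ N] {k : ℕ}
  {σ τ : PointedCone ℚ (ℚ ⊗[ℤ] N)} {p : Fin k → N} {e : Fin k → Module.Dual ℤ N}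

theorem isDualFrame_of_range_eq (hτ : IsStronglyConvexPolyhedral τ)
    (hp : Set.range p = rayVectors τ) (he : ∀ r s, e r (p s) = if r = s then -1 else 0) :
    IsDualFrame τ p e where
  mem_dualSemigroup u := by rw [mem_dualSemigroup_iff hτ, ← hp, Set.forall_mem_range]
  mem_perpLattice u := by rw [mem_perpLattice_iff_rayVectors hτ, ← hp, Set.forall_mem_range]
  apply_eq := he

/-- Adding the Demazure root with distinguished ray vector `p` preserves the elements of `S_σ`
that are positive on `p`. -/
theorem add_mem_dualSemigroup_of_isDemazureRoot (hσ : IsStronglyConvexPolyhedral σ) {p : N}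
    (hp : p ∈ rayVectors σ) {e : Module.Dual ℤ N} (he : IsDemazureRoot σ e) (hep : e p = -1)
    {u : Module.Dual ℤ N} (hu : u ∈ dualSemigroup σ) (hup : 0 < u p) :
    u + e ∈ dualSemigroup σ := by
  rw [mem_dualSemigroup_iff hσ] at hu ⊢
  obtain ⟨p', -, -, hq⟩ := he
  -- A Demazure root is negative on only one ray vector, so `p` is the distinguished one.
  have hpp : p = p' := by
    by_contra hne
    have := hq p hp hne
    omega
  intro q hqσ
  rw [LinearMap.add_apply]
  by_cases h : q = p
  · rw [h]
    omega
  · exact add_nonneg (hu q hqσ) (hq q hqσ (hpp ▸ h))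

end Cones

end

end RootMonoid

theorem theorem1 {K : Type*} [Field K] [IsAlgClosed K] [CharZero K]
    {N : Type*} [AddCommGroup N] [Module.Free ℤ N] [Module.Finite ℤ N]
    (σ τ : PointedCone ℚ (ℚ ⊗[ℤ] N))
    (hσ : RootMonoid.IsStronglyConvexPolyhedral σ)
    (hτ : τ.IsFaceOf σ) (hreg : RootMonoid.IsRegularCone τ)
    (k : ℕ) (hk : RootMonoid.coneDim τ = k)
    (p : Fin k → N) (hp : Function.Injective p)
    (hp_range : Set.range p = RootMonoid.rayVectors τ)
    (e₁ e₂ : Fin k → Module.Dual ℤ N)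
    (he₁ : ∀ r, RootMonoid.IsDemazureRoot σ (e₁ r))
    (he₂ : ∀ r, RootMonoid.IsDemazureRoot σ (e₂ r))
    (hcomp₁ : ∀ r s, e₁ r (p s) = if r = s then -1 else 0)
    (hcomp₂ : ∀ r s, e₂ r (p s) = if r = s then -1 else 0) :
    -- all exponents in the formula are nonnegative
    (∀ (u : RootMonoid.dualSemigroup σ) (r : Fin k), 0 ≤ (u : Module.Dual ℤ N) (p r)) ∧
    -- the formula defines a map `Δ : K[X] → K[X] ⊗ K[X]` (a unique linear map), which is a
    -- homomorphism of algebras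
    ∃ Δ : RootMonoid.CoordRing K σ →ₐ[K]
        RootMonoid.CoordRing K σ ⊗[K] RootMonoid.CoordRing K σ,
      (∀ Δ' : RootMonoid.CoordRing K σ →ₗ[K]
          RootMonoid.CoordRing K σ ⊗[K] RootMonoid.CoordRing K σ,
        (∀ u : RootMonoid.dualSemigroup σ,
          Algebra.TensorProduct.map (RootMonoid.inclM K σ) (RootMonoid.inclM K σ)
              (Δ' (RootMonoid.chiS K u)) =
            (RootMonoid.chi K (u : Module.Dual ℤ N) ⊗ₜ[K] RootMonoid.chi K u) *
              ∏ r : Fin k, (1 ⊗ₜ[K] RootMonoid.chi K (e₁ r) +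
                RootMonoid.chi K (e₂ r) ⊗ₜ[K] 1) ^ ((u : Module.Dual ℤ N) (p r)).toNat) ↔
        Δ' = Δ.toLinearMap) ∧
      -- `Δ` is a comultiplication with counit the point `x_τ`
      RootMonoid.IsComultiplication Δ (RootMonoid.distinguishedPoint K hτ.le) ∧
      -- it determines a monoid structure on `X` with neutral element `x_τ`
      ∃ _ : Monoid (RootMonoid.ToricVariety K σ),
        (∀ x y : RootMonoid.ToricVariety K σ, x * y = RootMonoid.pointMul Δ x y) ∧
        (1 : RootMonoid.ToricVariety K σ) = RootMonoid.distinguishedPoint K hτ.le ∧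
        -- the set of invertible elements is the principal open subset `X_τ`
        {x : RootMonoid.ToricVariety K σ | IsUnit x} = RootMonoid.toricSubset K hτ.le ∧
        (∃ f : RootMonoid.CoordRing K σ,
          RootMonoid.IsPrincipalOpenEmbedding (RootMonoid.restrictHom K hτ.le) f ∧
          RootMonoid.toricSubset K hτ.le = {x | x f ≠ 0}) ∧
        -- the differences `e₂ r - e₁ r` are characters of the torus `T = Hom(M(τ), Kˣ)`, and the
        -- group of invertible elements is isomorphic to the algebraic group they define: `Ψ` is
        -- an isomorphism of groups, given by an isomorphism of the coordinate algebras of the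
        -- varieties `X_τ` and `𝔸^k × T`
        ∃ c : Fin k → RootMonoid.perpLattice τ,
          (∀ r, (c r : Module.Dual ℤ N) = e₂ r - e₁ r) ∧
          ∃ (Ψ : RootMonoid.SemidirectGroup K c ≃* (RootMonoid.ToricVariety K σ)ˣ)
            (Φ : RootMonoid.CoordRing K τ ≃ₐ[K]
              RootMonoid.SemidirectCoordRing K (RootMonoid.perpLattice τ) k),
            ∀ (g : RootMonoid.SemidirectGroup K c) (f : RootMonoid.CoordRing K σ),
              (Ψ g : RootMonoid.ToricVariety K σ) f =
                RootMonoid.evalAt K g (Φ (RootMonoid.restrictHom K hτ.le f)) := by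
  have hsc := hσ.face hτ
  have h := RootMonoid.isDualFrame_of_range_eq hsc hp_range hcomp₁
  have h' := RootMonoid.isDualFrame_of_range_eq hsc hp_range hcomp₂
  have hpσ : ∀ r, p r ∈ RootMonoid.rayVectors σ := fun r =>
    RootMonoid.rayVectors_face hτ (hp_range ▸ Set.mem_range_self r)
  refine ⟨fun u => (h.mem_dualSemigroup _).1 (RootMonoid.dualSemigroup_anti hτ.le u.2), ?_⟩
  obtain ⟨Δ, hΔ⟩ := RootMonoid.exists_comul (K := K) h h' hτ.le fun u hu r hr =>
    ⟨RootMonoid.add_mem_dualSemigroup_of_isDemazureRoot hσ (hpσ r) (he₁ r)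
        (by rw [hcomp₁, if_pos rfl]) hu hr,
      RootMonoid.add_mem_dualSemigroup_of_isDemazureRoot hσ (hpσ r) (he₂ r)
        (by rw [hcomp₂, if_pos rfl]) hu hr⟩
  have hcom : RootMonoid.IsComultiplication Δ (RootMonoid.distinguishedPoint K hτ.le) :=
    (RootMonoid.isComultiplication_semidirectComul K (h.charDiff h')).of_injective
      (h.restrictToSemidirect K hτ.le) (h.restrictToSemidirect_injective K hτ.le) hΔ
      (h.evalAt_one_comp hτ.le _)
  have hincl : ∀ z, Algebra.TensorProduct.map (RootMonoid.inclM K σ) (RootMonoid.inclM K σ) z =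
      Algebra.TensorProduct.map (h.semidirectToLaurent K) (h.semidirectToLaurent K)
        (Algebra.TensorProduct.map (h.restrictToSemidirect K hτ.le)
          (h.restrictToSemidirect K hτ.le) z) := by
    intro z
    rw [← h.semidirectToLaurent_comp_restrict K hτ.le, Algebra.TensorProduct.map_comp]
    rfl
  refine ⟨Δ, fun Δ' => ?_, hcom, ?_⟩
  -- Both sides of the equivalence are compared on monomials; injectivity of `K[X_σ] ⊗ K[X_σ] → K[M]
  -- ⊗ K[M]` makes the formula determine `Δ'`.
  · rw [RootMonoid.linearMap_eq_iff_forall_chiS]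
    refine forall_congr' fun u => ?_
    rw [← h.comul_restrictToSemidirect_single K h' hτ.le u,
      ← (RootMonoid.tensorMap_injective RootMonoid.inclM_injective
        RootMonoid.inclM_injective).eq_iff, AlgHom.toLinearMap_apply, hincl (Δ _)]
    rw [show Algebra.TensorProduct.map _ _ (Δ (RootMonoid.chiS K u)) = _ from
      congr($hΔ (RootMonoid.chiS K u))]
    rfl
  obtain ⟨w, hw, hwτ, hwS⟩ := RootMonoid.exists_dualSemigroup_face_eq hσ hτ
  have hopen := RootMonoid.isPrincipalOpenEmbedding_restrictHom (K := K) hτ.le hw hwτ hwS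
  have hrange : RootMonoid.toricSubset K hτ.le =
      {x | x (RootMonoid.chiS K ⟨w, hw⟩) ≠ 0} := hopen.range_comp
  have hgrp := h.comul_chiS_of_mem hτ.le hΔ (u := ⟨w, hw⟩) hwτ
  have hone : RootMonoid.distinguishedPoint K hτ.le (RootMonoid.chiS K ⟨w, hw⟩) = 1 :=
    RootMonoid.distinguishedPoint_single_of_mem hτ.le hwτ
  let inst := RootMonoid.pointMonoid hcom
  let F : RootMonoid.SemidirectGroup K (h.charDiff h') →* RootMonoid.ToricVariety K σ :=
    { toFun := h.toPoint hτ.le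
      map_one' := h.evalAt_one_comp hτ.le _
      map_mul' := fun g g' => by
        rw [RootMonoid.IsDualFrame.toPoint, ← RootMonoid.pointMul_evalAt]
        exact (RootMonoid.pointMul_comp _ hΔ _ _).symm }
  have hFrange : Set.range F = RootMonoid.toricSubset K hτ.le := h.range_toPoint hτ.le _
  have hFinj : Function.Injective F := h.toPoint_injective hτ.le _ hopen
  have hunits : {x : RootMonoid.ToricVariety K σ | IsUnit x} =
      RootMonoid.toricSubset K hτ.le := by
    apply Set.Subset.antisymm
    · intro x hx
      obtain ⟨y, hxy⟩ := hx.exists_right_inv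
      rw [hrange]
      -- Group-likeness gives `χ^w(x) χ^w(y) = χ^w(x_τ) = 1`.
      exact RootMonoid.apply_ne_zero_of_pointMul_eq hgrp hxy hone
    · rw [← hFrange]
      rintro _ ⟨g, rfl⟩
      exact (Group.isUnit g).map F
  refine ⟨inst, fun _ _ => rfl, rfl, hunits, ⟨_, hopen, hrange⟩, h.charDiff h', fun _ => rfl,
    MulEquiv.ofBijective F.toHomUnits ⟨fun g g' hgg => hFinj congr(($hgg : _ˣ).val), fun x => ?_⟩,
    h.semidirectEquiv K, fun g f => rfl⟩
  -- Surjectivity onto the units: they form `X_τ`, which is the range of `F`.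
  obtain ⟨g, hg⟩ : (x : RootMonoid.ToricVariety K σ) ∈ Set.range F := by
    rw [hFrange, ← hunits]
    exact x.isUnit
  exact ⟨g, Units.ext hg⟩
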